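/- Let $n,d$ be non-negative integers and $\Delta E>0$. On $(\mathbb{C}^d)^{\otimes n}$ let $H_{\rm intrinsic}=\sum_{j=1}^n H_j$, where $H_j=\Delta E\sum_{r=0}^{d-1} r\,|r\rangle\langle r|_j$ acts on the $j$-th system, and on $(\mathbb{C}^d)^{\otimes n}\otimes\mathbb{C}^2$ (the last factor being an ancillary qubit $a$) let $H_{\rm tot}=H_{\rm intrinsic}+\Delta E\,|1\rangle\langle 1|_a$. Put $Z_a=|0\rangle\langle 0|_a-|1\rangle\langle 1|_a$ and, for $l,l'\in\{1,\dots,d-1\}$, $$R^{(l)}_{j,a}=|l-1\rangle\langle l|_j\otimes|1\rangle\langle 0|_a+|l\rangle\langle l-1|_j\otimes|0\rangle\langle 1|_a\qquad(1\le j\le n),$$ $$R^{(l,l')}_{j,j+1}=|l-1\rangle\langle l|_j\otimes|l'\rangle\langle l'-1|_{j+1}+|l\rangle\langle l-1|_j\otimes|l'-1\rangle\langle l'|_{j+1}\qquad(1\le j\le n-1).$$ (1) For every unitary $V$ on $(\mathbb{C}^d)^{\otimes n}$ with $[V,H_{\rm intrinsic}]=0$ there is a unitary $\tilde V$ on $(\mathbb{C}^d)^{\otimes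 n}\otimes\mathbb{C}^2$ such that $\tilde V(|\psi\rangle\otimes|0\rangle_a)=V|\psi\rangle\otimes|0\rangle_a$ for all $|\psi\rangle\in(\mathbb{C}^d)^{\otimes n}$ and such that both of the following hold. (a) $\tilde V$ is a finite product of gates of the form $\exp(i\theta Z_a)$, $\exp(i\theta R^{(l)}_{j,a})$ and $\exp(i\theta R^{(l,l')}_{j,j+1})$ with $\theta\in[0,2\pi)$. Each of these gates is unitary, is 2-local (it acts non-trivially on at most two of the $n+1$ sites, the sites being the $n$ systems and the ancilla) and commutes with $H_{\rm tot}$. (b) $\tilde V$ is implemented by a time-dependent Hamiltonian $$H(t)=H_{\rm tot}+g_a(t)Z_a+\sum_{j=1}^{n}\sum_{l=1}^{d-1} g^{(l)}_{j,a}(t)R^{(l)}_{j,a}+\sum_{j=1}^{n-1}\sum_{l,l'=1}^{d-1}g^{(l,l')}_{j,j+1}(t)R^{(l,l')}_{j,j+1}:$$ there are $T\ge 0$, continuous real functions $g_a,g^{(l)}_{j,a},g^{(l,l')}_{j,j+1}$ of $t\in\mathbb{R}$ vanishing for $t<0$ and for $t>T$, and a solution $U$ of $U'(t)=-iH(t)U(t)$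 for $t\ge 0$, $U(0)=I$, with $U(T)=\tilde V$. (2) (Qubits, $d=2$.) For every unitary $V$ on $(\mathbb{C}^2)^{\otimes n}$ that commutes with $\sum_{j=1}^n Z_j$ there is a unitary $\tilde V$ on $(\mathbb{C}^2)^{\otimes n}\otimes\mathbb{C}^2$ with $\tilde V(|\psi\rangle\otimes|0\rangle_a)=V|\psi\rangle\otimes|0\rangle_a$ for all $|\psi\rangle$ that is a finite product of gates $\exp(i\theta Z_a)$, $\exp(i\theta(X_jX_a+Y_jY_a))$ with $1\le j\le n$, and $\exp(i\theta(X_jX_{j+1}+Y_jY_{j+1}))$ with $1\le j\le n-1$, where $\theta\in\mathbb{R}$ and $X,Y,Z$ are the Pauli matrices. -/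

import Mathlib

open scoped Matrix Kronecker

noncomputable section

/-- Basis labels `r = (r_1, …, r_n)` of `(ℂ^d)^{⊗ n}`. -/
abbrev Config (n d : ℕ) : Type := Fin n → Fin d

/-- Basis labels of `(ℂ^d)^{⊗ n} ⊗ ℂ^2` (the last factor is the ancillary qubit). -/
abbrev ConfigA (n d : ℕ) : Type := Config n d × Fin 2

/-- Operators on `(ℂ^d)^{⊗ n}`, as matrices in the product basis. -/
abbrev SysOp (n d : ℕ) : Type := Matrix (Config n d) (Config n d) ℂ

/-- Operators on `(ℂ^d)^{⊗ n} ⊗ ℂ^2`, as matrices in the product basis. -/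
abbrev TotOp (n d : ℕ) : Type := Matrix (ConfigA n d) (ConfigA n d) ℂ

/-- `|r⟩⟨s|` on `ℂ^d`, for levels `r, s < d` numbered from `0`. -/
def ketBra (d r s : ℕ) : Matrix (Fin d) (Fin d) ℂ :=
  Matrix.of fun i k => if (i : ℕ) = r ∧ (k : ℕ) = s then 1 else 0

/-- The operator `A` on the `j`-th system, tensor the identity on the other systems. -/
def onSystem {n d : ℕ} (j : Fin n) (A : Matrix (Fin d) (Fin d) ℂ) : SysOp n d :=
  Matrix.of fun r s => if ∀ k, k ≠ j → r k = s k then A (r j) (s j) else 0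

/-- `A ⊗ 1` with the identity on the ancilla. -/
def liftSys {n d : ℕ} (A : SysOp n d) : TotOp n d := A ⊗ₖ (1 : Matrix (Fin 2) (Fin 2) ℂ)

/-- `1 ⊗ B` with `B` on the ancilla. -/
def onAncilla {n d : ℕ} (B : Matrix (Fin 2) (Fin 2) ℂ) : TotOp n d := (1 : SysOp n d) ⊗ₖ B

def pauliX : Matrix (Fin 2) (Fin 2) ℂ := !![0, 1; 1, 0]
def pauliY : Matrix (Fin 2) (Fin 2) ℂ := !![0, -Complex.I; Complex.I, 0]
def pauliZ : Matrix (Fin 2) (Fin 2) ℂ := !![1, 0; 0, -1]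

/-- Hamiltonian of a single system, `ΔE ∑_r r |r⟩⟨r|`. -/
def singleHam (d : ℕ) (ΔE : ℝ) : Matrix (Fin d) (Fin d) ℂ :=
  (ΔE : ℂ) • ∑ r ∈ Finset.range d, (r : ℂ) • ketBra d r r

/-- `H_intrinsic = ∑_j H_j`. -/
def intrinsicHam (n d : ℕ) (ΔE : ℝ) : SysOp n d := ∑ j : Fin n, onSystem j (singleHam d ΔE)

/-- `H_tot = ∑_j H_j + ΔE |1⟩⟨1|_a`. -/
def totalHam (n d : ℕ) (ΔE : ℝ) : TotOp n d :=
  liftSys (intrinsicHam n d ΔE) + (ΔE : ℂ) • onAncilla (ketBra 2 1 1)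

/-- `Z_a`. -/
def Za (n d : ℕ) : TotOp n d := onAncilla pauliZ

/-- `R^{(l)}_{j,a} = |l-1⟩⟨l|_j ⊗ |1⟩⟨0|_a + |l⟩⟨l-1|_j ⊗ |0⟩⟨1|_a`. -/
def Rja {n : ℕ} (d : ℕ) (j : Fin n) (l : ℕ) : TotOp n d :=
  liftSys (onSystem j (ketBra d (l - 1) l)) * onAncilla (ketBra 2 1 0)
    + liftSys (onSystem j (ketBra d l (l - 1))) * onAncilla (ketBra 2 0 1)

/-- `R^{(l,l')}_{j,k} = |l-1⟩⟨l|_j ⊗ |l'⟩⟨l'-1|_k + |l⟩⟨l-1|_j ⊗ |l'-1⟩⟨l'|_k`. -/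
def Rjk {n : ℕ} (d : ℕ) (j k : Fin n) (l l' : ℕ) : TotOp n d :=
  liftSys (onSystem j (ketBra d (l - 1) l) * onSystem k (ketBra d l' (l' - 1)))
    + liftSys (onSystem j (ketBra d l (l - 1)) * onSystem k (ketBra d (l' - 1) l'))

/-- The interactions `Z_a`, `R^{(l)}_{j,a}` and (nearest neighbours only) `R^{(l,l')}_{j,j+1}`. -/
inductive IsInteraction (n d : ℕ) : TotOp n d → Prop
  | anc : IsInteraction n d (Za n d)
  | sysAnc (j : Fin n) (l : ℕ) (hl : l ∈ Finset.Icc 1 (d - 1)) : IsInteraction n d (Rja d j l)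
  | sysSys (j k : Fin n) (hjk : (j : ℕ) + 1 = k) (l l' : ℕ) (hl : l ∈ Finset.Icc 1 (d - 1))
      (hl' : l' ∈ Finset.Icc 1 (d - 1)) : IsInteraction n d (Rjk d j k l l')

/-- The gates `exp(iθA)`, `θ ∈ [0, 2π)`, for the interactions `A` above. -/
def IsGate (n d : ℕ) (G : TotOp n d) : Prop :=
  ∃ A, IsInteraction n d A ∧ ∃ θ ∈ Set.Ico (0 : ℝ) (2 * Real.pi),
    G = NormedSpace.exp ((Complex.I * (θ : ℂ)) • A)

/-- The generators `Z_a`, `X_j X_a + Y_j Y_a` and `X_j X_{j+1} + Y_j Y_{j+1}` on `n` qubits and an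
ancillary qubit. -/
inductive IsXYInteraction (n : ℕ) : TotOp n 2 → Prop
  | anc : IsXYInteraction n (Za n 2)
  | sysAnc (j : Fin n) : IsXYInteraction n
      (liftSys (onSystem j pauliX) * onAncilla pauliX
        + liftSys (onSystem j pauliY) * onAncilla pauliY)
  | sysSys (j k : Fin n) (hjk : (j : ℕ) + 1 = k) : IsXYInteraction n
      (liftSys (onSystem j pauliX * onSystem k pauliX)
        + liftSys (onSystem j pauliY * onSystem k pauliY))

/-- The gates `exp(iθA)`, `θ` real, for the qubit interactions `A` above. -/
def IsXYGate (n : ℕ) (G : TotOp n 2) : Prop :=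
  ∃ A, IsXYInteraction n A ∧ ∃ θ : ℝ, G = NormedSpace.exp ((Complex.I * (θ : ℂ)) • A)

/-- The state `|ψ⟩ ⊗ |0⟩_a`. -/
def withAncilla {n d : ℕ} (ψ : Config n d → ℂ) : ConfigA n d → ℂ :=
  fun x => if x.2 = 0 then ψ x.1 else 0

/-- The level of a site in a basis state: `some j` is system `j`, `none` is the ancilla. -/
def siteLevel {n d : ℕ} (x : ConfigA n d) : Option (Fin n) → ℕ
  | some j => x.1 j
  | none => x.2

/-- `A` acts non-trivially only on the sites in `S`: it is an operator on these sites tensor the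
identity on all the other sites. -/
def ActsOn {n d : ℕ} (S : Finset (Option (Fin n))) (A : TotOp n d) : Prop :=
  (∀ x y, (∃ s ∉ S, siteLevel x s ≠ siteLevel y s) → A x y = 0) ∧
  (∀ x y x' y', (∀ s ∉ S, siteLevel x s = siteLevel y s) →
    (∀ s ∉ S, siteLevel x' s = siteLevel y' s) →
    (∀ s ∈ S, siteLevel x s = siteLevel x' s ∧ siteLevel y s = siteLevel y' s) →
    A x y = A x' y')

/-- `A` acts non-trivially on at most `k` of the `n + 1` sites (`n` systems and the ancilla). -/
def IsKLocal {n d : ℕ} (k : ℕ) (A : TotOp n d) : Prop :=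
  ∃ S : Finset (Option (Fin n)), S.card ≤ k ∧ ActsOn S A

/-- Ordered nearest-neighbour pairs `(j, j + 1)`. -/
def nnPairs (n : ℕ) : Finset (Fin n × Fin n) :=
  Finset.univ.filter fun p => (p.1 : ℕ) + 1 = p.2

/-- The controlled Hamiltonian
`H_tot + g_a(t) Z_a + ∑_{j,l} g^{(l)}_{j,a}(t) R^{(l)}_{j,a}
  + ∑_{j,l,l'} g^{(l,l')}_{j,j+1}(t) R^{(l,l')}_{j,j+1}`. -/
def controlledHam (n d : ℕ) (ΔE : ℝ) (gA : ℝ → ℝ) (gSA : Fin n → ℕ → ℝ → ℝ)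
    (gSS : Fin n → Fin n → ℕ → ℕ → ℝ → ℝ) (t : ℝ) : TotOp n d :=
  totalHam n d ΔE + (gA t : ℂ) • Za n d
    + ∑ j : Fin n, ∑ l ∈ Finset.Icc 1 (d - 1), (gSA j l t : ℂ) • Rja d j l
    + ∑ p ∈ nnPairs n, ∑ l ∈ Finset.Icc 1 (d - 1), ∑ l' ∈ Finset.Icc 1 (d - 1),
        (gSS p.1 p.2 l l' t : ℂ) • Rjk d p.1 p.2 l l'

/-- A continuous real control function that vanishes for `t < 0` and for `t > T`. -/
def IsControl (T : ℝ) (g : ℝ → ℝ) : Prop :=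
  Continuous g ∧ ∀ t, t < 0 ∨ T < t → g t = 0

/-- `W` is the value at some time `T ≥ 0` of the solution of `U' = -i H(t) U`, `U(0) = 1`, for the
controlled Hamiltonian with suitable control functions. -/
def IsImplementable (n d : ℕ) (ΔE : ℝ) (W : TotOp n d) : Prop :=
  ∃ T : ℝ, 0 ≤ T ∧ ∃ (gA : ℝ → ℝ) (gSA : Fin n → ℕ → ℝ → ℝ)
    (gSS : Fin n → Fin n → ℕ → ℕ → ℝ → ℝ),
    IsControl T gA ∧ (∀ j l, IsControl T (gSA j l)) ∧ (∀ j k l l', IsControl T (gSS j k l l')) ∧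
    ∃ U : ℝ → TotOp n d, U 0 = 1 ∧
      (∀ t, 0 ≤ t → ∀ x y, HasDerivWithinAt (fun s => U s x y)
        (((-Complex.I) • (controlledHam n d ΔE gA gSA gSS t * U t)) x y) (Set.Ici 0) t) ∧
      U T = W

end

/-!
The gates are rotations generated by *hops*: partial isometries `A` with `A * A = 0`, for which
`exp(iθ(A + A*))` rotates, by the same angle, every pair of basis vectors that `A` matches up. The
proof shows that products of gates rotate each single pair of basis vectors of equal energy by an
arbitrary element of `SU(2)`; from these and phases, Givens rotations generate everything.

* *From joint to conditioned rotations.* `Good K A` says that all the joint `SU(2)` rotations of the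
  hop `A` lie in `K`. The phases come from `Z_a` for the hops to the ancilla, and from these hops
  for the exchanges of neighbours. If `A` and `B` are orthogonal and the rotations of `A + B` and
  of `A - B` are available, dividing one by the other leaves `B` alone (`good_of_add_of_sub`). Such
  a relative sign arises from a triangle of three sites that interact pairwise: the exchange of two
  sites made through the third one acquires a sign depending on the level of the third
  (`good_triangle`). A system, a neighbour and the ancilla form such a triangle. It conditions a
  hop between a system `j` and the ancilla on the level of a neighbour of `j`, and a further swap
  with the ancilla on that of any other system as well (`good_control_control`).
* *Separation.* The sets of basis vectors on which a hop can be conditioned are closed under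
  intersections and differences: rotations on a common part are isolated by conjugation and
  division (`good_inter`, `good_of_add`). They separate the basis vectors, so the hop between `j`
  and the ancilla is available on each single pair of basis vectors (`good_pair_of_hop`).
* *Connectivity.* Basis vectors of the same energy are connected by hops through the ancilla
  (`linked_of_levelSum_eq`), hence all the pairs of equal energy can be rotated.
* *Phases.* A rotation of a pair has determinant `1`. On states with the ancilla in `|0⟩`, the phase
  of a single excited basis vector is nevertheless adjusted freely, the opposite phase being put on a
  vector with the ancilla in `|1⟩`; the phase of the ground state comes from `exp(iθ Z_a)`. The
  Givens reduction `mem_of_block` then gives every energy-conserving unitary on the systems.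

For the implementation by a Hamiltonian, each gate is the result of a smooth pulse of one control,
whose duration is the period `2π / ΔE` of the free evolution. The energy levels are multiples of `ΔE`
and each interaction commutes with `totalHam`, so in the rotating frame the pulses compose to the
product of the gates, and at multiples of the period the free evolution is the identity
(`Drives.gate_mul`, `freeEvolution_period`). For qubits, `X X + Y Y` is twice an exchange
interaction, so the second claim uses the same gates.
-/

/-! ### Rotations generated by hops -/

section StarAlgebra

variable {𝒜 : Type*} [Ring 𝒜]

theorem zero_assoc {u v : 𝒜} (h : u * v = 0) (z : 𝒜) : u * (v * z) = 0 := by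
  rw [← mul_assoc, h, zero_mul]

theorem iso_assoc {u v w : 𝒜} (h : u * (v * u) = w) (z : 𝒜) : u * (v * (u * z)) = w * z := by
  rw [← h]; simp only [mul_assoc]

variable [StarRing 𝒜]

/-- A hop: a partial isometry whose initial and final spaces are orthogonal. It matches up the
vectors of its initial space `star A * A` with those of its final space `A * star A`. -/
structure IsHop (A : 𝒜) : Prop where
  sq : A * A = 0
  iso : A * (star A * A) = A

/-- Two partial isometries whose initial and final spaces are all orthogonal to each other. -/
structure Orth (A B : 𝒜) : Prop where
  mul : A * B = 0
  mul' : B * A = 0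
  star_right : A * star B = 0
  star_left : star A * B = 0

theorem Orth.symm {A B : 𝒜} (h : Orth A B) : Orth B A where
  mul := h.mul'
  mul' := h.mul
  star_right := by simpa using congrArg star h.star_right
  star_left := by simpa using congrArg star h.star_left

theorem Orth.neg_right {A B : 𝒜} (h : Orth A B) : Orth A (-B) where
  mul := by simp [h.mul]
  mul' := by simp [h.mul']
  star_right := by simp [h.star_right]
  star_left := by simp [h.star_left]

theorem Orth.neg_left {A B : 𝒜} (h : Orth A B) : Orth (-A) B :=
  h.symm.neg_right.symm

theorem Orth.add_right {A B C : 𝒜} (h : Orth A B) (h' : Orth A C) : Orth A (B + C) where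
  mul := by simp [mul_add, h.mul, h'.mul]
  mul' := by simp [add_mul, h.mul', h'.mul']
  star_right := by simp [mul_add, h.star_right, h'.star_right]
  star_left := by simp [mul_add, h.star_left, h'.star_left]

theorem IsHop.star_sq {A : 𝒜} (h : IsHop A) : star A * star A = 0 := by
  simpa using congrArg star h.sq

theorem IsHop.star_iso {A : 𝒜} (h : IsHop A) : star A * (A * star A) = star A := by
  simpa [mul_assoc] using congrArg star h.iso

theorem IsHop.neg {A : 𝒜} (h : IsHop A) : IsHop (-A) where
  sq := by simp [h.sq]
  iso := by simp [h.iso]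

theorem IsHop.add {A B : 𝒜} (hA : IsHop A) (hB : IsHop B) (h : Orth A B) : IsHop (A + B) where
  sq := by simp [add_mul, mul_add, hA.sq, hB.sq, h.mul, h.mul']
  iso := by
    simp [add_mul, mul_add, h.star_left, h.symm.star_left, ← mul_assoc,
      h.star_right, h.symm.star_right]
    simp [mul_assoc, hA.iso, hB.iso]

variable [Algebra ℂ 𝒜]

/-- The element `[[α, β], [-conj β, conj α]]` of `SU(2)` acting on every pair of vectors matched by
the hop `A` (final vector first), and as the identity on the orthogonal complement. -/
noncomputable def rot (A : 𝒜) (α β : ℂ) : 𝒜 :=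
  1 + (α - 1) • (A * star A) + (star α - 1) • (star A * A) + β • A - star β • star A

theorem rot_mul {A : 𝒜} (h : IsHop A) (α β α' β' : ℂ) :
    rot A α β * rot A α' β' = rot A (α * α' - β * star β') (α * β' + β * star α') := by
  unfold rot
  simp only [mul_add, add_mul, mul_sub, sub_mul, mul_one, one_mul, smul_mul_smul_comm, mul_assoc,
    h.sq, h.star_sq, h.iso, h.star_iso, zero_assoc h.sq, zero_assoc h.star_sq, mul_zero,
    smul_zero, star_mul', star_sub, star_add, star_star]
  module

theorem rot_one_zero (A : 𝒜) : rot A 1 0 = 1 := by simp [rot]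

theorem rot_star (A : 𝒜) (α β : ℂ) : rot (star A) α β = rot A (star α) (-star β) := by
  unfold rot
  simp only [star_star, star_neg]
  module

theorem conj_rot {W : 𝒜} (h : star W * W = 1) (h' : W * star W = 1) (A : 𝒜) (α β : ℂ) :
    W * rot A α β * star W = rot (W * A * star W) α β := by
  have key : ∀ z, star W * (W * z) = z := fun z => by rw [← mul_assoc, h, one_mul]
  unfold rot
  simp only [mul_add, add_mul, mul_sub, sub_mul, mul_one, mul_assoc, h', star_mul, star_star, key,
    mul_smul_comm, smul_mul_assoc]

theorem rot_add {A B : 𝒜} (h : Orth A B) (α β : ℂ) :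
    rot (A + B) α β = rot A α β * rot B α β := by
  unfold rot
  simp only [mul_add, add_mul, mul_sub, sub_mul, mul_one, one_mul, smul_mul_smul_comm, mul_assoc,
    h.mul, h.star_left, h.star_right, h.symm.star_left, h.symm.star_right, zero_assoc h.mul,
    zero_assoc h.star_left, zero_assoc h.star_right, mul_zero, smul_zero, star_add]
  have e : star A * star B = 0 := by simpa using congrArg star h.mul'
  simp only [e, zero_assoc e, mul_zero, smul_zero]
  module

theorem rot_mul_of_orth {A B : 𝒜} (h : Orth A B) (α β : ℂ) : rot A α β * B = B := by
  unfold rot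
  simp only [add_mul, sub_mul, one_mul, smul_mul_assoc, mul_assoc, h.mul, h.star_left, mul_zero,
    smul_zero]
  simp

theorem mul_rot_of_orth {A B : 𝒜} (h : Orth A B) (α β : ℂ) : B * rot A α β = B := by
  unfold rot
  simp only [mul_add, mul_sub, mul_one, mul_smul_comm, ← mul_assoc, h.mul', h.symm.star_right,
    zero_mul, smul_zero]
  simp

variable [StarModule ℂ 𝒜]

theorem star_rot (A : 𝒜) (α β : ℂ) : star (rot A α β) = rot A (star α) (-β) := by
  unfold rot
  simp only [star_add, star_sub, star_smul, star_mul, star_star, star_one, star_neg]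
  module

theorem rot_smul (A : 𝒜) (α β c : ℂ) (hc : c * star c = 1) :
    rot (c • A) α β = rot A α (β * c) := by
  unfold rot
  simp only [star_smul, smul_mul_smul_comm, hc, mul_comm (star c) c, one_smul, star_mul']
  module

theorem rot_mul_star {A : 𝒜} (h : IsHop A) {α β : ℂ} (hαβ : α * star α + β * star β = 1) :
    rot A α β * star (rot A α β) = 1 := by
  rw [star_rot, rot_mul h, ← rot_one_zero A]
  congr 1
  · rw [star_neg, mul_neg, sub_neg_eq_add, hαβ]
  · simp [mul_comm]

theorem star_mul_rot {A : 𝒜} (h : IsHop A) {α β : ℂ} (hαβ : α * star α + β * star β = 1) :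
    star (rot A α β) * rot A α β = 1 := by
  rw [star_rot, rot_mul h, ← rot_one_zero A]
  congr 1
  · rw [neg_mul, sub_neg_eq_add, mul_comm (star α), hαβ]
  · simp [mul_comm]

theorem conj_of_orth {A B : 𝒜} (h : Orth A B) (α β : ℂ) :
    rot A α β * B * star (rot A α β) = B := by
  rw [rot_mul_of_orth h, star_rot, mul_rot_of_orth h]

/-- A diagonal element of `SU(2)` only changes the phase of its hop. -/
theorem conj_phase_self {A : 𝒜} (h : IsHop A) (c : ℂ) :
    rot A c 0 * A * star (rot A c 0) = (c * c) • A := by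
  have h1 : rot A c 0 * A = c • A := by
    unfold rot
    simp only [add_mul, sub_mul, one_mul, smul_mul_assoc, mul_assoc, h.iso, h.sq, mul_zero,
      smul_zero, star_zero, zero_smul]
    module
  have h2 : A * star (rot A c 0) = c • A := by
    rw [star_rot]
    unfold rot
    simp only [mul_add, mul_sub, mul_one, mul_smul_comm, h.iso, zero_assoc h.sq,
      smul_zero, star_zero, zero_smul, neg_zero, star_star]
    module
  rw [h1, smul_mul_assoc, h2, smul_smul]

end StarAlgebra

/-! ### The hops all of whose rotations lie in a given group -/

section Good

variable {𝒜 : Type*} [Ring 𝒜] [StarRing 𝒜] [Algebra ℂ 𝒜]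

/-- All the rotations of the hop `A` lie in `K`. -/
def Good (K : Submonoid 𝒜) (A : 𝒜) : Prop :=
  ∀ α β : ℂ, α * star α + β * star β = 1 → rot A α β ∈ K

variable {K : Submonoid 𝒜}

theorem Good.adjoint {A : 𝒜} (h : Good K A) : Good K (star A) := by
  intro α β hαβ
  rw [rot_star]
  refine h _ _ ?_
  simp only [star_star, star_neg]
  linear_combination hαβ

theorem Good.conj (hK : ∀ g ∈ K, star g ∈ K) {A W : 𝒜} (h : Good K A) (hW : W ∈ K)
    (h1 : star W * W = 1) (h2 : W * star W = 1) : Good K (W * A * star W) := by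
  intro α β hαβ
  rw [← conj_rot h1 h2]
  exact K.mul_mem (K.mul_mem hW (h _ _ hαβ)) (hK _ hW)

/-- The elements of `SU(2)` with real diagonal generate `SU(2)`. -/
theorem good_of_real {A : 𝒜} (hA : IsHop A)
    (h : ∀ (a : ℝ) (b : ℂ), (a : ℂ) * a + b * star b = 1 → rot A a b ∈ K) : Good K A := by
  intro α β hαβ
  obtain ⟨c, hc, hα⟩ : ∃ c : ℂ, c * star c = 1 ∧ α = c * (‖α‖ : ℂ) := by
    by_cases h0 : α = 0
    · exact ⟨1, by simp, by simp [h0]⟩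
    · have : (‖α‖ : ℂ) ≠ 0 := by simpa using h0
      refine ⟨α / ‖α‖, ?_, by field_simp⟩
      have e : α * star α = (‖α‖ : ℂ) ^ 2 := Complex.mul_conj' α
      rw [star_div₀, show star (‖α‖ : ℂ) = ‖α‖ from Complex.conj_ofReal _, div_mul_div_comm, e,
        ← sq, div_self (pow_ne_zero 2 this)]
  have e1 : rot A α β = rot A (0 : ℝ) c * rot A (0 : ℝ) (-1) * rot A (‖α‖ : ℝ) (star c * β) := by
    rw [rot_mul hA, rot_mul hA]
    congr 1
    · simp only [Complex.ofReal_zero, star_neg, star_one, star_zero]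
      linear_combination hα
    · simp
      have hc' : c * (starRingEnd ℂ) c = 1 := hc
      linear_combination -β * hc'
  rw [e1]
  refine K.mul_mem (K.mul_mem (h _ _ ?_) (h _ _ ?_)) (h _ _ ?_)
  · simpa using hc
  · simp
  · rw [← hαβ]
    have : α * star α = (‖α‖ : ℂ) * ‖α‖ := by rw [← sq]; exact Complex.mul_conj' α
    rw [this, star_mul', star_star]
    linear_combination (β * star β) * hc

variable [StarModule ℂ 𝒜]

theorem Good.smul {A : 𝒜} (h : Good K A) {c : ℂ} (hc : c * star c = 1) : Good K (c • A) := by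
  intro α β hαβ
  rw [rot_smul _ _ _ _ hc]
  refine h _ _ ?_
  rw [star_mul', ← hαβ]
  linear_combination (β * star β) * hc

theorem Good.neg {A : 𝒜} (h : Good K A) : Good K (-A) := by
  have := h.smul (c := -1) (by simp)
  simpa using this

theorem good_of_phases {A : 𝒜} (hA : IsHop A)
    (h : ∀ (θ : ℝ) (c : ℂ), c * star c = 1 →
      rot (c • A) (Real.cos θ : ℂ) (Complex.I * Real.sin θ) ∈ K) : Good K A := by
  refine good_of_real hA fun a b hab => ?_
  have hb : b * star b = (‖b‖ : ℂ) ^ 2 := Complex.mul_conj' b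
  have hr : a ^ 2 + ‖b‖ ^ 2 = 1 := by
    have : ((a ^ 2 + ‖b‖ ^ 2 : ℝ) : ℂ) = 1 := by push_cast; rw [← hb, ← hab]; ring
    exact_mod_cast this
  obtain ⟨θ, hc, hs⟩ : ∃ θ : ℝ, Real.cos θ = a ∧ Real.sin θ = ‖b‖ := by
    refine ⟨Real.arccos a, Real.cos_arccos (by nlinarith) (by nlinarith), ?_⟩
    rw [Real.sin_arccos, show 1 - a ^ 2 = ‖b‖ ^ 2 by linarith, Real.sqrt_sq (norm_nonneg _)]
  by_cases h0 : b = 0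
  · have := h θ 1 (by simp)
    simpa [hc, hs, h0] using this
  · have h0' : (‖b‖ : ℂ) ≠ 0 := by simpa using h0
    have hu : (-Complex.I * (b / ‖b‖)) * star (-Complex.I * (b / ‖b‖)) = 1 := by
      rw [star_mul', star_div₀, show star (‖b‖ : ℂ) = ‖b‖ from Complex.conj_ofReal _, star_neg,
        show star Complex.I = -Complex.I from Complex.conj_I]
      have : -Complex.I * (b / ‖b‖) * (- -Complex.I * (star b / ‖b‖)) =
        (b * star b) / (‖b‖ : ℂ) ^ 2 * (-(Complex.I * Complex.I)) := by ring
      rw [this, hb, div_self (pow_ne_zero 2 h0'), Complex.I_mul_I]; simp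
    have := h θ _ hu
    rw [rot_smul _ _ _ _ hu, hc, hs] at this
    convert this using 2
    have : Complex.I * ‖b‖ * (-Complex.I * (b / ‖b‖)) = -(Complex.I * Complex.I) * b := by
      field_simp
    rw [this]; simp

/-- If the rotations of two orthogonal hops are available jointly, both with equal and with
opposite signs, then the quotient of the two joint rotations is the square of a rotation of the
second hop, and these squares generate `SU(2)`. -/
theorem good_of_add_of_sub (hK : ∀ g ∈ K, star g ∈ K) {A B : 𝒜} (hA : IsHop A) (hB : IsHop B)
    (h : Orth A B) (h1 : Good K (A + B)) (h2 : Good K (A - B)) : Good K B := by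
  refine good_of_phases hB fun θ c hc => ?_
  have hs : (Real.cos (θ / 2) : ℂ) * star (Real.cos (θ / 2) : ℂ) +
      (Complex.I * Real.sin (θ / 2) * c) * star (Complex.I * Real.sin (θ / 2) * c) = 1 := by
    have e : star (Real.sin (θ / 2) : ℂ) = Real.sin (θ / 2) := Complex.conj_ofReal _
    have e' : star (Real.cos (θ / 2) : ℂ) = Real.cos (θ / 2) := Complex.conj_ofReal _
    have e2 : star Complex.I = -Complex.I := Complex.conj_I
    have e3 : (Real.cos (θ / 2) : ℂ) ^ 2 + (Real.sin (θ / 2) : ℂ) ^ 2 = 1 := by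
      exact_mod_cast Real.cos_sq_add_sin_sq (θ / 2)
    rw [star_mul', star_mul', e, e', e2]
    have : (Real.cos (θ / 2) : ℂ) * Real.cos (θ / 2) +
      (Complex.I * Real.sin (θ / 2) * c) * (-Complex.I * Real.sin (θ / 2) * star c) =
      (Real.cos (θ / 2) : ℂ) ^ 2 - (Complex.I * Complex.I) * (Real.sin (θ / 2) : ℂ) ^ 2 *
        (c * star c) := by ring
    rw [this, hc, Complex.I_mul_I]; linear_combination e3
  have m1 := h1 _ _ hs
  have m2 := hK _ (h2 _ _ hs)
  rw [rot_add h] at m1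
  rw [sub_eq_add_neg, rot_add h.neg_right, star_mul] at m2
  have hneg : rot (-B) (Real.cos (θ / 2) : ℂ) (Complex.I * Real.sin (θ / 2) * c)
      = rot B (Real.cos (θ / 2) : ℂ) (-(Complex.I * Real.sin (θ / 2) * c)) := by
    have := rot_smul B (Real.cos (θ / 2) : ℂ) (Complex.I * Real.sin (θ / 2) * c) (-1) (by simp)
    simpa using this
  have m3 := K.mul_mem m2 m1
  have key : star (rot A (Real.cos (θ / 2) : ℂ) (Complex.I * Real.sin (θ / 2) * c)) *
      rot A (Real.cos (θ / 2) : ℂ) (Complex.I * Real.sin (θ / 2) * c) = 1 := star_mul_rot hA hs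
  rw [mul_assoc, ← mul_assoc (star (rot A _ _)), key, one_mul, hneg, star_rot, rot_mul hB] at m3
  rw [rot_smul _ _ _ _ hc]
  have e : star (Real.sin (θ / 2) : ℂ) = Real.sin (θ / 2) := Complex.conj_ofReal _
  have e' : star (Real.cos (θ / 2) : ℂ) = Real.cos (θ / 2) := Complex.conj_ofReal _
  have e2 : star Complex.I = -Complex.I := Complex.conj_I
  have e4 : (Real.cos θ : ℂ) = (Real.cos (θ / 2) : ℂ) ^ 2 - (Real.sin (θ / 2) : ℂ) ^ 2 := by
    rw [show θ = 2 * (θ / 2) by ring, Real.cos_two_mul']; push_cast; ring_nf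
  have e5 : (Real.sin θ : ℂ) = 2 * (Real.sin (θ / 2) : ℂ) * (Real.cos (θ / 2) : ℂ) := by
    rw [show θ = 2 * (θ / 2) by ring, Real.sin_two_mul]; push_cast; ring_nf
  convert m3 using 2
  · rw [star_mul', star_mul', e, e', e2, e4]
    have : (Real.cos (θ / 2) : ℂ) * Real.cos (θ / 2) - - -(Complex.I * Real.sin (θ / 2) * c) *
      (-Complex.I * Real.sin (θ / 2) * star c) =
      (Real.cos (θ / 2) : ℂ) ^ 2 + (Complex.I * Complex.I) * (Real.sin (θ / 2) : ℂ) ^ 2 *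
        (c * star c) := by ring
    rw [this, hc, Complex.I_mul_I]; ring
  · rw [e', e5]; ring

theorem good_of_add {A B : 𝒜} (hK : ∀ g ∈ K, star g ∈ K) (hA : IsHop A) (h : Orth A B)
    (h1 : Good K (A + B)) (h2 : Good K A) : Good K B := by
  intro α β hαβ
  have := K.mul_mem (hK _ (h2 α β hαβ)) (h1 α β hαβ)
  rwa [rot_add h, ← mul_assoc, star_mul_rot hA hαβ, one_mul] at this

/-- Rotations that are available on `A + B` and on `A + C` are available on the common part `A`. -/
theorem good_inter (hK : ∀ g ∈ K, star g ∈ K) {A B C : 𝒜} (hA : IsHop A) (hB : IsHop B)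
    (hC : IsHop C) (hAB : Orth A B) (hAC : Orth A C) (hBC : Orth B C) (h1 : Good K (A + B))
    (h2 : Good K (A + C)) : Good K A := by
  have hi : Complex.I * star Complex.I + 0 * star 0 = 1 := by
    rw [show star Complex.I = -Complex.I from Complex.conj_I]; simp
  have hH := hA.add hB hAB
  -- the phases `±i` on `A + B` turn `A` into `-A` and leave `C` alone
  have h3 := h2.conj hK (h1 _ _ hi) (star_mul_rot hH hi) (rot_mul_star hH hi)
  have e : rot (A + B) Complex.I 0 * (A + C) * star (rot (A + B) Complex.I 0) = C - A := by
    have c1 : rot B Complex.I 0 * A * star (rot B Complex.I 0) = A := conj_of_orth hAB.symm _ _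
    have c2 := conj_phase_self hA Complex.I
    have c4 := conj_of_orth hAC Complex.I 0
    have c5 := conj_of_orth hBC Complex.I 0
    rw [rot_add hAB, star_mul]
    calc _ = rot A Complex.I 0 * (rot B Complex.I 0 * A * star (rot B Complex.I 0)) *
          star (rot A Complex.I 0) + rot A Complex.I 0 *
          (rot B Complex.I 0 * C * star (rot B Complex.I 0)) * star (rot A Complex.I 0) := by
            noncomm_ring
      _ = _ := by rw [c1, c5, c2, c4, Complex.I_mul_I]; simp [sub_eq_neg_add]
  rw [e] at h3
  exact good_of_add_of_sub hK hC hA hAC.symm (by rwa [add_comm]) h3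

/-- The sign between the two parts of `A - B + C` gives the rotations of each part of `A + B`. -/
theorem good_of_signs (hK : ∀ g ∈ K, star g ∈ K) {A B C : 𝒜} (hA : IsHop A) (hB : IsHop B)
    (hC : IsHop C) (hAB : Orth A B) (hAC : Orth A C) (hBC : Orth B C) (h1 : Good K (A + B))
    (h2 : Good K (A - B + C)) : Good K A ∧ Good K B := by
  have hi : Complex.I * star Complex.I + 0 * star 0 = 1 := by
    rw [show star Complex.I = -Complex.I from Complex.conj_I]; simp
  have hH := hA.add hB hAB
  have h3 := h2.conj hK (h1 _ _ hi) (star_mul_rot hH hi) (rot_mul_star hH hi)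
  have e : rot (A + B) Complex.I 0 * (A - B + C) * star (rot (A + B) Complex.I 0)
      = C - (A - B) := by
    have c1 : rot B Complex.I 0 * A * star (rot B Complex.I 0) = A := conj_of_orth hAB.symm _ _
    have c2 := conj_phase_self hA Complex.I
    have c3 := conj_phase_self hB Complex.I
    have c4 := conj_of_orth hAC Complex.I 0
    have c5 := conj_of_orth hBC Complex.I 0
    have c6 := conj_of_orth hAB Complex.I 0
    rw [rot_add hAB, star_mul]
    calc _ = rot A Complex.I 0 * (rot B Complex.I 0 * A * star (rot B Complex.I 0)) *
          star (rot A Complex.I 0) - rot A Complex.I 0 *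
          (rot B Complex.I 0 * B * star (rot B Complex.I 0)) * star (rot A Complex.I 0) +
          rot A Complex.I 0 *
          (rot B Complex.I 0 * C * star (rot B Complex.I 0)) * star (rot A Complex.I 0) := by
            noncomm_ring
      _ = _ := by
        rw [c1, c5, c3, c2, c4, Complex.I_mul_I, neg_one_smul, neg_one_smul, mul_neg, neg_mul, c6]
        abel
  rw [e] at h3
  have hD : IsHop (A - B) := by rw [sub_eq_add_neg]; exact hA.add hB.neg hAB.neg_right
  have hCD : Orth C (A - B) := by
    rw [sub_eq_add_neg]; exact hAC.symm.add_right hBC.symm.neg_right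
  have h4 : Good K (A - B) :=
    good_of_add_of_sub hK hC hD hCD (by rwa [add_comm]) h3
  refine ⟨good_of_add_of_sub hK hB hA hAB.symm (by rwa [add_comm]) ?_,
    good_of_add_of_sub hK hA hB hAB h1 h4⟩
  simpa using h4.neg

end Good

/-! ### Conditioning a hop on the level of another system -/

section Controls

variable {𝒜 : Type*} [Ring 𝒜] [StarRing 𝒜]

/-- `y` commutes with `x` and with `star x`, as operators on different sites do. -/
structure StarCommute (x y : 𝒜) : Prop where
  comm : y * x = x * y
  comm_star : y * star x = star x * y

theorem StarCommute.symm {x y : 𝒜} (h : StarCommute x y) : StarCommute y x where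
  comm := h.comm.symm
  comm_star := by simpa using congrArg star h.comm_star

/-- Rewriting rules that move `x` and `star x` to the left of `y` and `star y`. -/
theorem StarCommute.rules {x y : 𝒜} (h : StarCommute x y) :
    y * x = x * y ∧ y * star x = star x * y ∧ star y * x = x * star y ∧
    star y * star x = star x * star y ∧ (∀ z, y * (x * z) = x * (y * z)) ∧
    (∀ z, y * (star x * z) = star x * (y * z)) ∧ (∀ z, star y * (x * z) = x * (star y * z)) ∧
    (∀ z, star y * (star x * z) = star x * (star y * z)) := by
  have h1 := h.symm.comm_star.symm
  have h2 : star y * star x = star x * star y := by simpa using congrArg star h.comm.symm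
  refine ⟨h.comm, h.comm_star, h1, h2, fun z => ?_, fun z => ?_, fun z => ?_, fun z => ?_⟩
  · rw [← mul_assoc, h.comm, mul_assoc]
  · rw [← mul_assoc, h.comm_star, mul_assoc]
  · rw [← mul_assoc, h1, mul_assoc]
  · rw [← mul_assoc, h2, mul_assoc]

/-- Rewriting rules that reduce the words in `A` and `star A`. -/
theorem IsHop.rules {A : 𝒜} (h : IsHop A) :
    A * A = 0 ∧ star A * star A = 0 ∧ A * (star A * A) = A ∧ star A * (A * star A) = star A ∧
    (∀ z, A * (A * z) = 0) ∧ (∀ z, star A * (star A * z) = 0) ∧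
    (∀ z, A * (star A * (A * z)) = A * z) ∧
    (∀ z, star A * (A * (star A * z)) = star A * z) :=
  ⟨h.sq, h.star_sq, h.iso, h.star_iso, zero_assoc h.sq, zero_assoc h.star_sq, iso_assoc h.iso,
    iso_assoc h.star_iso⟩

theorem qubit_rules {f : 𝒜} (h : f * star f + star f * f = 1) :
    star f * f = 1 - f * star f ∧ (∀ z, star f * (f * z) = z - f * (star f * z)) := by
  have h1 : star f * f = 1 - f * star f := by rw [← h]; abel
  refine ⟨h1, fun z => ?_⟩
  rw [← mul_assoc, h1, sub_mul, one_mul, mul_assoc]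

/-- A projection `P` that commutes with `A`: a condition under which the hop `A` is performed. -/
structure IsCondition (A P : 𝒜) : Prop where
  idem : P * P = P
  self : star P = P
  comm : P * A = A * P

theorem IsCondition.comm_star {A P : 𝒜} (h : IsCondition A P) : P * star A = star A * P := by
  simpa [h.self] using congrArg star h.comm.symm

theorem IsCondition.compl {A P : 𝒜} (h : IsCondition A P) : IsCondition A (1 - P) where
  idem := by simp [mul_sub, sub_mul, h.idem]
  self := by simp [h.self]
  comm := by simp [mul_sub, sub_mul, h.comm]

theorem IsCondition.mul {A P Q : 𝒜} (hP : IsCondition A P) (hQ : IsCondition A Q)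
    (h : P * Q = Q * P) : IsCondition A (P * Q) where
  idem := by rw [mul_assoc, ← mul_assoc Q, ← h, mul_assoc, hQ.idem, ← mul_assoc, hP.idem]
  self := by rw [star_mul, hP.self, hQ.self, h]
  comm := by rw [mul_assoc, hQ.comm, ← mul_assoc, hP.comm, mul_assoc]

theorem IsCondition.isHop {A P : 𝒜} (h : IsCondition A P) (hA : IsHop A) : IsHop (A * P) where
  sq := by rw [mul_assoc, ← mul_assoc P, h.comm, mul_assoc, ← mul_assoc, hA.sq, zero_mul]
  iso := by
    have e : P * (P * (star A * (A * P))) = star A * (A * P) := by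
      rw [← mul_assoc, h.idem, ← mul_assoc, h.comm_star, mul_assoc, ← mul_assoc P, h.comm,
        mul_assoc A, h.idem]
    rw [star_mul, h.self, mul_assoc, mul_assoc P, e, ← mul_assoc, ← mul_assoc, mul_assoc A, hA.iso]

theorem IsCondition.orth {A P Q : 𝒜} (h : IsCondition A P) (h' : IsCondition A Q)
    (hPQ : P * Q = 0) (hQP : Q * P = 0) : Orth (A * P) (A * Q) where
  mul := by rw [mul_assoc, ← mul_assoc P, h.comm, mul_assoc, hPQ, mul_zero, mul_zero]
  mul' := by rw [mul_assoc, ← mul_assoc Q, h'.comm, mul_assoc, hQP, mul_zero, mul_zero]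
  star_right := by rw [star_mul, h'.self, mul_assoc, ← mul_assoc P, hPQ, zero_mul, mul_zero]
  star_left := by
    rw [star_mul, h.self, h.comm_star, mul_assoc, ← mul_assoc P, h.comm, mul_assoc, hPQ, mul_zero,
      mul_zero]

variable [Algebra ℂ 𝒜]

theorem rot_zero_one (A : 𝒜) : rot A 0 1 = 1 - A * star A - star A * A + A - star A := by
  unfold rot
  simp only [star_zero, star_one, one_smul, zero_sub, neg_smul]
  abel

variable [StarModule ℂ 𝒜] {K : Submonoid 𝒜}

theorem Good.swap (hK : ∀ g ∈ K, star g ∈ K) {A B C : 𝒜} (hA : Good K A) (hB : Good K B)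
    (hB' : IsHop B) (h : rot B 0 1 * A * star (rot B 0 1) = C) : Good K C := by
  have h1 : (0 : ℂ) * star 0 + 1 * star 1 = 1 := by simp
  exact h ▸ hA.conj hK (hB _ _ h1) (star_mul_rot hB' h1) (rot_mul_star hB' h1)

/-- On three sites that interact pairwise, the hop between the first two, conditioned on the level
of the third one, is available: it is obtained directly and, with a sign that depends on the
third site, through the third site. -/
theorem good_triangle (hK : ∀ g ∈ K, star g ∈ K) {a b f : 𝒜} (ha : IsHop a) (hb : IsHop b)
    (hf : IsHop f) (hf1 : f * star f + star f * f = 1) (hab : StarCommute a b)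
    (haf : StarCommute a f) (hbf : StarCommute b f) (h1 : Good K (a * f)) (h2 : Good K (b * f))
    (h3 : Good K (a * star b)) :
    Good K (a * star b * (f * star f)) ∧ Good K (a * star b * (star f * f)) := by
  have hB : IsHop (b * f) := by
    constructor <;> simp only [star_mul, mul_assoc, hbf.rules, hb.rules, hf.rules]
  have h4 : Good K (a * star b * (f * star f) - a * star b * (star f * f) +
      (a * f - a * f * (b * star b) - a * f * (star b * b))) := by
    refine h1.swap hK h2 hB ?_
    rw [rot_zero_one]
    simp only [star_add, star_sub, star_one, mul_add, add_mul, mul_sub, sub_mul, mul_one, one_mul,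
      star_mul, star_star, mul_assoc, hab.rules, haf.rules, hbf.rules, hb.rules,
      hf.rules, qubit_rules hf1, mul_zero, sub_zero, add_zero, sub_self]
    abel
  have h5 : a * star b * (f * star f) + a * star b * (star f * f) = a * star b := by
    rw [← mul_add, hf1, mul_one]
  refine good_of_signs hK ?_ ?_ ?_ ?_ ?_ ?_ (by rwa [h5]) h4 <;> constructor <;>
  · simp only [star_sub, mul_sub, sub_mul, mul_one, star_mul, star_star, mul_assoc,
      hab.rules, haf.rules, hbf.rules, ha.rules, hb.rules, hf.rules, qubit_rules hf1, mul_zero,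
      sub_zero, sub_self]
    try abel

/-- The hop `a * f` between a system and the ancilla, conditioned on the level of a second
system. -/
theorem good_control (hK : ∀ g ∈ K, star g ∈ K) {a b f : 𝒜} (ha : IsHop a) (hb : IsHop b)
    (hf : IsHop f) (hf1 : f * star f + star f * f = 1) (hab : StarCommute a b)
    (haf : StarCommute a f) (hbf : StarCommute b f) (h1 : Good K (a * f)) (h2 : Good K (b * f))
    (h3 : Good K (a * star b)) :
    Good K (a * f * (star b * b)) ∧ Good K (a * f * (b * star b)) := by
  have hB : IsHop (b * f) := by
    constructor <;> simp only [star_mul, mul_assoc, hbf.rules, hb.rules, hf.rules]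
  obtain ⟨h4, h5⟩ := good_triangle hK ha hb hf hf1 hab haf hbf h1 h2 h3
  refine ⟨h4.neg.swap hK h2 hB ?_, h5.swap hK h2 hB ?_⟩ <;>
  · rw [rot_zero_one]
    simp only [star_add, star_sub, star_one, mul_add, add_mul, mul_sub, sub_mul, mul_one, one_mul,
      star_mul, star_star, mul_assoc, hab.rules, haf.rules, hbf.rules, hb.rules,
      hf.rules, qubit_rules hf1, mul_zero, sub_zero, add_zero, sub_self, mul_neg, neg_mul]
    abel

/-- The hop `a * f` between a system and the ancilla, conditioned on the levels of a second and of
a third system. The third system need only interact with the ancilla. -/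
theorem good_control_control (hK : ∀ g ∈ K, star g ∈ K) {a b g f : 𝒜} (ha : IsHop a)
    (hb : IsHop b) (hg : IsHop g) (hf : IsHop f) (hf1 : f * star f + star f * f = 1)
    (hab : StarCommute a b) (hag : StarCommute a g) (hbg : StarCommute b g)
    (haf : StarCommute a f) (hbf : StarCommute b f) (hgf : StarCommute g f)
    (h1 : Good K (a * f)) (h2 : Good K (b * f)) (h3 : Good K (a * star b))
    (h4 : Good K (g * f)) :
    Good K (a * f * (star b * b) * (1 - g * star g)) ∧
      Good K (a * f * (b * star b) * (1 - star g * g)) := by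
  have hB : IsHop (b * f) := by
    constructor <;> simp only [star_mul, mul_assoc, hbf.rules, hb.rules, hf.rules]
  have hG : IsHop (g * f) := by
    constructor <;> simp only [star_mul, mul_assoc, hgf.rules, hg.rules, hf.rules]
  obtain ⟨h5, h6⟩ := good_triangle hK ha hb hf hf1 hab haf hbf h1 h2 h3
  obtain ⟨h7, h8⟩ := good_control hK ha hb hf hf1 hab haf hbf h1 h2 h3
  -- swapping the third system with the ancilla correlates the ancilla with the third system
  have h9 : Good K (a * star b * (f * star f - g * star g * (f * star f) +
      star g * g * (star f * f))) := by
    refine h5.swap hK h4 hG ?_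
    rw [rot_zero_one]
    simp only [star_add, star_sub, star_one, mul_add, add_mul, mul_sub, sub_mul, mul_one, one_mul,
      star_mul, star_star, mul_assoc, hag.rules, hbg.rules, haf.rules, hbf.rules,
      hgf.rules, hg.rules, hf.rules, qubit_rules hf1, mul_zero, sub_zero, add_zero, sub_self]
    abel
  have h10 : Good K (a * star b * (star f * f - star g * g * (star f * f) +
      g * star g * (f * star f))) := by
    refine h6.swap hK h4 hG ?_
    rw [rot_zero_one]
    simp only [star_add, star_sub, star_one, mul_add, add_mul, mul_sub, sub_mul, mul_one, one_mul,
      star_mul, star_star, mul_assoc, hag.rules, hbg.rules, haf.rules, hbf.rules,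
      hgf.rules, hg.rules, hf.rules, qubit_rules hf1, mul_zero, sub_zero, add_zero, sub_self]
    abel
  -- swapping the second system with the ancilla turns this into a hop to the ancilla
  have h11 : Good K (a * f * (star b * b) * (1 - g * star g) +
      -(a * f * (b * star b) * (star g * g))) := by
    refine h9.neg.swap hK h2 hB ?_
    rw [rot_zero_one]
    simp only [star_add, star_sub, star_one, mul_add, add_mul, mul_sub, sub_mul, mul_one, one_mul,
      star_mul, star_star, mul_assoc, hab.rules, hbg.rules, haf.rules, hbf.rules,
      hgf.rules, hb.rules, hf.rules, qubit_rules hf1, mul_zero, sub_zero, add_zero, sub_self,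
      mul_neg, neg_mul]
    abel
  have h12 : Good K (a * f * (b * star b) * (1 - star g * g) +
      -(a * f * (star b * b) * (g * star g))) := by
    refine h10.swap hK h2 hB ?_
    rw [rot_zero_one]
    simp only [star_add, star_sub, star_one, mul_add, add_mul, mul_sub, sub_mul, mul_one, one_mul,
      star_mul, star_star, mul_assoc, hab.rules, hbg.rules, haf.rules, hbf.rules,
      hgf.rules, hb.rules, hf.rules, qubit_rules hf1, mul_zero, sub_zero, add_zero, sub_self]
    abel
  have hA : IsHop (a * f) := by
    constructor <;> simp only [star_mul, mul_assoc, haf.rules, ha.rules, hf.rules]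
  have p1 : IsCondition (a * f) (star b * b) := by
    constructor <;> simp only [star_mul, star_star, mul_assoc, hab.rules, hbf.rules, hb.rules]
  have p2 : IsCondition (a * f) (b * star b) := by
    constructor <;> simp only [star_mul, star_star, mul_assoc, hab.rules, hbf.rules, hb.rules]
  have p3 : IsCondition (a * f) (star g * g) := by
    constructor <;> simp only [star_mul, star_star, mul_assoc, hag.rules, hgf.rules, hg.rules]
  have p4 : IsCondition (a * f) (g * star g) := by
    constructor <;> simp only [star_mul, star_star, mul_assoc, hag.rules, hgf.rules, hg.rules]
  have c2 : b * star b * (star g * g) = star g * g * (b * star b) := by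
    simp only [mul_assoc, hbg.rules]
  have c3 : star b * b * (g * star g) = g * star g * (star b * b) := by
    simp only [mul_assoc, hbg.rules]
  constructor
  · have q1 := p1.mul p4.compl (by rw [mul_sub, sub_mul, c3, mul_one, one_mul])
    have q2 := p2.mul p3 c2
    have q3 := p1.mul p4 c3
    rw [mul_assoc, mul_assoc (a * f) (b * star b)] at h11
    rw [mul_assoc]
    refine good_inter hK (q1.isHop hA) (q2.isHop hA).neg (q3.isHop hA)
      (q1.orth q2 ?_ ?_).neg_right (q1.orth q3 ?_ ?_)
      (q2.orth q3 ?_ ?_).neg_left h11 ?_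
    case refine_7 => rw [← mul_add, ← mul_add, sub_add_cancel, mul_one]; exact h7
    all_goals
      simp only [mul_sub, sub_mul, mul_one, mul_assoc, hbg.rules, hb.rules, hg.rules, mul_zero,
        sub_self]
  · have q1 := p2.mul p3.compl (by rw [mul_sub, sub_mul, c2, mul_one, one_mul])
    have q2 := p1.mul p4 c3
    have q3 := p2.mul p3 c2
    rw [mul_assoc, mul_assoc (a * f) (star b * b)] at h12
    rw [mul_assoc]
    refine good_inter hK (q1.isHop hA) (q2.isHop hA).neg (q3.isHop hA)
      (q1.orth q2 ?_ ?_).neg_right (q1.orth q3 ?_ ?_)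
      (q2.orth q3 ?_ ?_).neg_left h12 ?_
    case refine_7 => rw [← mul_add, ← mul_add, sub_add_cancel, mul_one]; exact h8
    all_goals
      simp only [mul_sub, sub_mul, mul_one, mul_assoc, hbg.rules, hb.rules, hg.rules, mul_zero,
        sub_self]

/-- If the hop `a * f` of one system to the ancilla is available, then so are all the phases of the
exchange `a * star b` with a second system. -/
theorem conj_phase_exchange {a b f : 𝒜} (ha : IsHop a) (hf : IsHop f)
    (hf1 : f * star f + star f * f = 1) (hab : StarCommute a b)
    (haf : StarCommute a f) (hbf : StarCommute b f) (c : ℂ) :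
    rot (a * f) c 0 * (a * star b) * star (rot (a * f) c 0) = c • (a * star b) := by
  rw [star_rot]
  unfold rot
  simp only [star_zero, neg_zero, zero_smul, add_zero, sub_zero, add_mul, mul_add, sub_mul,
    smul_mul_assoc, mul_smul_comm, one_mul, mul_one, star_mul, mul_assoc, star_star,
    hab.rules, haf.rules, hbf.rules, ha.rules, hf.rules, qubit_rules hf1, mul_sub, sub_self,
    mul_zero, smul_zero, smul_sub]
  module

end Controls

/-! ### Operators on single sites -/

section Sites

variable {n d : ℕ}

theorem conjTranspose_ketBra (d r s : ℕ) : (ketBra d r s)ᴴ = ketBra d s r := by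
  ext i k
  simp only [ketBra, Matrix.conjTranspose_apply, Matrix.of_apply, and_comm]
  split_ifs <;> simp

theorem ketBra_mul (d r s t : ℕ) (hs : s < d) :
    ketBra d r s * ketBra d s t = ketBra d r t := by
  ext i k
  rw [Matrix.mul_apply, Finset.sum_eq_single ⟨s, hs⟩]
  · simp only [ketBra, Matrix.of_apply, and_true, true_and, mul_ite, mul_one, mul_zero]
    split_ifs <;> simp_all
  · intro u _ hu
    have : (u : ℕ) ≠ s := fun h => hu (Fin.ext h)
    simp [ketBra, this]
  · simp

theorem ketBra_mul_of_ne (d r : ℕ) {s t : ℕ} (u : ℕ) (h : s ≠ t) :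
    ketBra d r s * ketBra d t u = 0 := by
  ext i k
  rw [Matrix.mul_apply]
  refine Finset.sum_eq_zero fun v _ => ?_
  simp only [ketBra, Matrix.of_apply]
  split_ifs with h1 h2
  · exact absurd (h1.2.symm.trans h2.1) h
  all_goals simp

theorem onSystem_mul_apply (j : Fin n) (A : Matrix (Fin d) (Fin d) ℂ) (M : SysOp n d)
    (r s : Config n d) :
    (onSystem j A * M) r s = ∑ u, A (r j) u * M (Function.update r j u) s := by
  rw [Matrix.mul_apply]
  simp only [onSystem, Matrix.of_apply, ite_mul, zero_mul]
  rw [← Finset.sum_filter]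
  refine Finset.sum_nbij' (fun t => t j) (fun u => Function.update r j u) ?_ ?_ ?_ ?_ ?_
  · simp
  · intro u _
    simp only [Finset.mem_filter, Finset.mem_univ, true_and]
    intro k hk
    rw [Function.update_of_ne hk]
  · intro t ht
    simp only [Finset.mem_filter, Finset.mem_univ, true_and] at ht
    funext k
    by_cases hk : k = j
    · subst hk; simp
    · rw [Function.update_of_ne hk, ht k hk]
  · simp
  · intro t ht
    simp only [Finset.mem_filter, Finset.mem_univ, true_and] at ht
    have : Function.update r j (t j) = t := by
      funext k
      by_cases hk : k = j
      · subst hk; simp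
      · rw [Function.update_of_ne hk, ht k hk]
    rw [this]

theorem onSystem_mul (j : Fin n) (A B : Matrix (Fin d) (Fin d) ℂ) :
    onSystem j A * onSystem j B = onSystem j (A * B) := by
  ext r s
  rw [onSystem_mul_apply]
  simp only [onSystem, Matrix.of_apply, Function.update_self, Matrix.mul_apply]
  have : ∀ u, (∀ k, k ≠ j → Function.update r j u k = s k) ↔ (∀ k, k ≠ j → r k = s k) :=
    fun u => forall_congr' fun k => imp_congr_right fun hk => by rw [Function.update_of_ne hk]
  simp only [this]
  split_ifs <;> simp

theorem onSystem_mul_onSystem_apply {j k : Fin n} (h : j ≠ k) (A B : Matrix (Fin d) (Fin d) ℂ)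
    (r s : Config n d) : (onSystem j A * onSystem k B) r s =
      if ∀ i, i ≠ j → i ≠ k → r i = s i then A (r j) (s j) * B (r k) (s k) else 0 := by
  rw [onSystem_mul_apply]
  simp only [onSystem, Matrix.of_apply, Function.update_of_ne h.symm]
  rw [Finset.sum_eq_single (s j)]
  · have : (∀ i, i ≠ k → Function.update r j (s j) i = s i) ↔
        ∀ i, i ≠ j → i ≠ k → r i = s i := by
      constructor
      · intro H i hj hk
        rw [← H i hk, Function.update_of_ne hj]
      · intro H i hk
        by_cases hj : i = j
        · subst hj; simp
        · rw [Function.update_of_ne hj, H i hj hk]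
    simp only [this, mul_ite, mul_zero]
  · intro u _ hu
    rw [if_neg, mul_zero]
    intro H
    exact hu (by simpa using H j h)
  · simp

theorem onSystem_comm {j k : Fin n} (h : j ≠ k) (A B : Matrix (Fin d) (Fin d) ℂ) :
    onSystem k B * onSystem j A = onSystem j A * onSystem k B := by
  ext r s
  rw [onSystem_mul_onSystem_apply h, onSystem_mul_onSystem_apply h.symm]
  have : (∀ i, i ≠ k → i ≠ j → r i = s i) ↔ ∀ i, i ≠ j → i ≠ k → r i = s i :=
    forall_congr' fun i => ⟨fun H a b => H b a, fun H a b => H b a⟩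
  simp only [this, mul_comm]

theorem conjTranspose_onSystem (j : Fin n) (A : Matrix (Fin d) (Fin d) ℂ) :
    (onSystem j A)ᴴ = onSystem j Aᴴ := by
  ext r s
  simp only [onSystem, Matrix.conjTranspose_apply, Matrix.of_apply, eq_comm]
  split_ifs <;> simp

theorem liftSys_mul (A B : SysOp n d) : liftSys A * liftSys B = liftSys (A * B) := by
  unfold liftSys
  rw [← Matrix.mul_kronecker_mul, one_mul]

theorem onAncilla_mul (A B : Matrix (Fin 2) (Fin 2) ℂ) :
    (onAncilla A * onAncilla B : TotOp n d) = onAncilla (A * B) := by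
  unfold onAncilla
  rw [← Matrix.mul_kronecker_mul, one_mul]

theorem conjTranspose_liftSys (A : SysOp n d) : (liftSys A)ᴴ = liftSys Aᴴ := by
  unfold liftSys
  rw [Matrix.conjTranspose_kronecker, Matrix.conjTranspose_one]

theorem conjTranspose_onAncilla (A : Matrix (Fin 2) (Fin 2) ℂ) :
    (onAncilla A : TotOp n d)ᴴ = onAncilla Aᴴ := by
  unfold onAncilla
  rw [Matrix.conjTranspose_kronecker, Matrix.conjTranspose_one]

theorem liftSys_mul_onAncilla (A : SysOp n d) (B : Matrix (Fin 2) (Fin 2) ℂ) :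
    liftSys A * onAncilla B = A ⊗ₖ B := by
  unfold liftSys onAncilla
  rw [← Matrix.mul_kronecker_mul, one_mul, mul_one]

theorem onAncilla_mul_liftSys (A : SysOp n d) (B : Matrix (Fin 2) (Fin 2) ℂ) :
    onAncilla B * liftSys A = liftSys A * onAncilla B := by
  rw [liftSys_mul_onAncilla]
  unfold liftSys onAncilla
  rw [← Matrix.mul_kronecker_mul, one_mul, mul_one]

/-- `|r⟩⟨s|` on the `j`-th system. -/
def sysUnit (n d : ℕ) (j : Fin n) (r s : ℕ) : TotOp n d := liftSys (onSystem j (ketBra d r s))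

/-- `|r⟩⟨s|` on the ancilla. -/
def ancUnit (n d : ℕ) (r s : ℕ) : TotOp n d := onAncilla (ketBra 2 r s)

theorem star_sysUnit (j : Fin n) (r s : ℕ) : star (sysUnit n d j r s) = sysUnit n d j s r := by
  rw [Matrix.star_eq_conjTranspose, sysUnit, conjTranspose_liftSys, conjTranspose_onSystem,
    conjTranspose_ketBra, sysUnit]

theorem star_ancUnit (r s : ℕ) : star (ancUnit n d r s) = ancUnit n d s r := by
  rw [Matrix.star_eq_conjTranspose, ancUnit, conjTranspose_onAncilla, conjTranspose_ketBra,
    ancUnit]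

theorem sysUnit_mul (j : Fin n) (r : ℕ) {s : ℕ} (t : ℕ) (hs : s < d) :
    sysUnit n d j r s * sysUnit n d j s t = sysUnit n d j r t := by
  rw [sysUnit, sysUnit, liftSys_mul, onSystem_mul, ketBra_mul _ _ _ _ hs, sysUnit]

theorem ancUnit_mul (r : ℕ) {s : ℕ} (t : ℕ) (hs : s < 2) :
    ancUnit n d r s * ancUnit n d s t = ancUnit n d r t := by
  rw [ancUnit, ancUnit, onAncilla_mul, ketBra_mul _ _ _ _ hs, ancUnit]

theorem isHop_sysUnit (j : Fin n) {r s : ℕ} (hr : r < d) (hs : s < d) (h : r ≠ s) :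
    IsHop (sysUnit n d j r s) where
  sq := by
    rw [sysUnit, liftSys_mul, onSystem_mul, ketBra_mul_of_ne _ _ _ h.symm]
    ext x y
    simp [liftSys, onSystem, Matrix.kroneckerMap_apply]
  iso := by rw [star_sysUnit, sysUnit_mul _ _ _ hr, sysUnit_mul _ _ _ hs]

theorem isHop_ancUnit : IsHop (ancUnit n d 0 1) where
  sq := by
    rw [ancUnit, onAncilla_mul, ketBra_mul_of_ne _ _ _ one_ne_zero]
    ext x y
    simp [onAncilla, Matrix.kroneckerMap_apply]
  iso := by rw [star_ancUnit, ancUnit_mul _ _ (by norm_num), ancUnit_mul _ _ (by norm_num)]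

theorem ancUnit_complete :
    ancUnit n d 0 1 * star (ancUnit n d 0 1) + star (ancUnit n d 0 1) * ancUnit n d 0 1 = 1 := by
  rw [star_ancUnit, ancUnit_mul _ _ (by norm_num), ancUnit_mul _ _ (by norm_num), ancUnit, ancUnit,
    onAncilla, onAncilla, ← Matrix.kronecker_add,
    show ketBra 2 0 0 + ketBra 2 1 1 = 1 by ext i k; fin_cases i <;> fin_cases k <;> simp [ketBra],
    Matrix.one_kronecker_one]

theorem starCommute_sysUnit {j k : Fin n} (h : j ≠ k) (r s t u : ℕ) :
    StarCommute (sysUnit n d j r s) (sysUnit n d k t u) where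
  comm := by rw [sysUnit, sysUnit, liftSys_mul, liftSys_mul, onSystem_comm h]
  comm_star := by
    rw [star_sysUnit, sysUnit, sysUnit, liftSys_mul, liftSys_mul, onSystem_comm h]

theorem starCommute_sysUnit_ancUnit (j : Fin n) (r s t u : ℕ) :
    StarCommute (sysUnit n d j r s) (ancUnit n d t u) where
  comm := by rw [sysUnit, ancUnit, onAncilla_mul_liftSys]
  comm_star := by rw [star_sysUnit, sysUnit, ancUnit, onAncilla_mul_liftSys]

/-- The projection onto the span of the basis vectors in `C`. -/
def proj {ι : Type*} [DecidableEq ι] (C : Finset ι) : Matrix ι ι ℂ :=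
  Matrix.diagonal fun x => if x ∈ C then 1 else 0

theorem sysUnit_self (j : Fin n) (m : ℕ) :
    sysUnit n d j m m = proj (Finset.univ.filter fun x : ConfigA n d => (x.1 j : ℕ) = m) := by
  ext x y
  rw [sysUnit, liftSys, Matrix.kroneckerMap_apply, onSystem, Matrix.of_apply, ketBra,
    Matrix.of_apply, proj, Matrix.diagonal_apply, Matrix.one_apply]
  by_cases h : x = y
  · subst h; simp
  · rw [if_neg h]
    split_ifs with h1 h2 h3 <;> simp
    apply h
    refine Prod.ext (funext fun k => ?_) h3
    by_cases hk : k = j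
    · subst hk; exact Fin.ext (h2.1.trans h2.2.symm)
    · exact h1 k hk

theorem sysUnit_mul_ancUnit_apply (j : Fin n) (l : ℕ) (x y : ConfigA n d) :
    (sysUnit n d j l (l - 1) * ancUnit n d 0 1) x y =
      if (∀ k, k ≠ j → x.1 k = y.1 k) ∧ (x.1 j : ℕ) = l ∧ (y.1 j : ℕ) = l - 1 ∧
        x.2 = 0 ∧ y.2 = 1 then 1 else 0 := by
  rw [sysUnit, ancUnit, liftSys_mul_onAncilla, Matrix.kroneckerMap_apply, onSystem,
    Matrix.of_apply, ketBra, ketBra, Matrix.of_apply, Matrix.of_apply]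
  have e0 : ((x.2 : ℕ) = 0) ↔ x.2 = 0 := by rw [Fin.ext_iff]; rfl
  have e1 : ((y.2 : ℕ) = 1) ↔ y.2 = 1 := by rw [Fin.ext_iff]; rfl
  simp only [e0, e1]
  split_ifs <;> simp_all

end Sites

/-! ### From conditioned hops to rotations of a pair of basis vectors -/

section Separation

variable {ι : Type*} [Fintype ι] [DecidableEq ι]

theorem proj_mul (C D : Finset ι) : proj C * proj D = proj (C ∩ D) := by
  rw [proj, proj, Matrix.diagonal_mul_diagonal, proj]
  congr 1
  funext x
  by_cases h : x ∈ C <;> by_cases h' : x ∈ D <;> simp [h, h']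

theorem one_sub_proj (C : Finset ι) : 1 - proj C = proj Cᶜ := by
  rw [proj, proj, ← Matrix.diagonal_one, Matrix.diagonal_sub]
  congr 1
  funext x
  by_cases h : x ∈ C <;> simp [h]

theorem mul_proj_apply (A : Matrix ι ι ℂ) (C : Finset ι) (x y : ι) :
    (A * proj C) x y = if y ∈ C then A x y else 0 := by
  rw [proj, Matrix.mul_diagonal]; simp

theorem isCondition_proj {A : Matrix ι ι ℂ} {C : Finset ι}
    (h : ∀ x y, A x y ≠ 0 → (x ∈ C ↔ y ∈ C)) : IsCondition A (proj C) where
  idem := by rw [proj_mul, Finset.inter_self]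
  self := by
    rw [Matrix.star_eq_conjTranspose, proj, Matrix.diagonal_conjTranspose]
    congr 1
    funext x
    by_cases h : x ∈ C <;> simp [h]
  comm := by
    ext x y
    rw [proj, Matrix.mul_diagonal, Matrix.diagonal_mul]
    by_cases h0 : A x y = 0
    · simp [h0]
    · simp [h x y h0, mul_comm]

/-- The sets `C` of basis vectors such that the hop `A` is available conditioned on `C`. -/
structure IsControlSet (K : Submonoid (Matrix ι ι ℂ)) (A : Matrix ι ι ℂ) (C : Finset ι) :
    Prop where
  iff : ∀ x y, A x y ≠ 0 → (x ∈ C ↔ y ∈ C)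
  good : Good K (A * proj C)

section

variable {K : Submonoid (Matrix ι ι ℂ)} {A : Matrix ι ι ℂ} {C D : Finset ι}

theorem orth_proj (hC : ∀ x y, A x y ≠ 0 → (x ∈ C ↔ y ∈ C))
    (hD : ∀ x y, A x y ≠ 0 → (x ∈ D ↔ y ∈ D)) (h : Disjoint C D) :
    Orth (A * proj C) (A * proj D) := by
  have e : ∀ E F : Finset ι, Disjoint E F → (proj E : Matrix ι ι ℂ) * proj F = 0 := by
    intro E F hEF
    rw [proj_mul, Finset.disjoint_iff_inter_eq_empty.1 hEF]
    simp [proj]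
  exact (isCondition_proj hC).orth (isCondition_proj hD) (e _ _ h) (e _ _ h.symm)

theorem mul_proj_add (A : Matrix ι ι ℂ) (C D : Finset ι) :
    A * proj (C ∩ D) + A * proj (C \ D) = A * proj C := by
  rw [← mul_add, Finset.sdiff_eq_inter_compl, ← proj_mul, ← proj_mul, ← one_sub_proj, ← mul_add,
    add_sub_cancel, mul_one]

theorem IsControlSet.inter (hK : ∀ g ∈ K, star g ∈ K) (hA : IsHop A) (hC : IsControlSet K A C)
    (hD : IsControlSet K A D) : IsControlSet K A (C ∩ D) where
  iff x y h := by simp [hC.iff x y h, hD.iff x y h]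
  good := by
    have i1 : ∀ x y, A x y ≠ 0 → (x ∈ C ∩ D ↔ y ∈ C ∩ D) :=
      fun x y h => by simp [hC.iff x y h, hD.iff x y h]
    have i2 : ∀ x y, A x y ≠ 0 → (x ∈ C \ D ↔ y ∈ C \ D) :=
      fun x y h => by simp [hC.iff x y h, hD.iff x y h]
    have i3 : ∀ x y, A x y ≠ 0 → (x ∈ D \ C ↔ y ∈ D \ C) :=
      fun x y h => by simp [hC.iff x y h, hD.iff x y h]
    refine good_inter hK ((isCondition_proj i1).isHop hA) ((isCondition_proj i2).isHop hA)
      ((isCondition_proj i3).isHop hA) (orth_proj i1 i2 ?_) (orth_proj i1 i3 ?_)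
      (orth_proj i2 i3 ?_) ?_ ?_
    · exact (Finset.disjoint_sdiff_inter C D).symm
    · rw [Finset.inter_comm]; exact (Finset.disjoint_sdiff_inter D C).symm
    · exact disjoint_sdiff_sdiff
    · rw [mul_proj_add]; exact hC.good
    · rw [Finset.inter_comm, mul_proj_add]; exact hD.good

theorem IsControlSet.sdiff (hK : ∀ g ∈ K, star g ∈ K) (hA : IsHop A) (hC : IsControlSet K A C)
    (hD : IsControlSet K A D) : IsControlSet K A (C \ D) where
  iff x y h := by simp [hC.iff x y h, hD.iff x y h]
  good := by
    have h := hC.inter hK hA hD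
    have i2 : ∀ x y, A x y ≠ 0 → (x ∈ C \ D ↔ y ∈ C \ D) :=
      fun x y h => by simp [hC.iff x y h, hD.iff x y h]
    refine good_of_add hK ((isCondition_proj h.iff).isHop hA)
      (orth_proj h.iff i2 (Finset.disjoint_sdiff_inter C D).symm) ?_ h.good
    rw [mul_proj_add]; exact hC.good

end

/-- Control sets are closed under intersections and differences. Hence if they separate the vector
`p` from all the other vectors that `A` moves to, then the hop to `p` is available by itself: it
is conditioned on the smallest control set containing `p`. -/
theorem good_single {K : Submonoid (Matrix ι ι ℂ)} (hK : ∀ g ∈ K, star g ∈ K) {A : Matrix ι ι ℂ}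
    (hA : IsHop A) (hgood : Good K A) {p q : ι} (hpq : ∀ y, A p y = if y = q then 1 else 0)
    (hsep : ∀ x y, A x y ≠ 0 → x ≠ p → ∃ C : Finset ι, IsControlSet K A C ∧
        ((p ∈ C ∧ x ∉ C) ∨ (p ∉ C ∧ x ∈ C))) :
    Good K (Matrix.single p q 1) := by
  classical
  let S : Finset (Finset ι) := Finset.univ.filter fun C => IsControlSet K A C ∧ p ∈ C
  have hS : ∀ C, C ∈ S ↔ IsControlSet K A C ∧ p ∈ C := by
    intro C; simp [S]
  have hne : S.Nonempty := ⟨Finset.univ, by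
    rw [hS]
    refine ⟨⟨by simp, ?_⟩, by simp⟩
    rwa [show proj (Finset.univ : Finset ι) = 1 by simp [proj], mul_one]⟩
  obtain ⟨C, hC, hmin⟩ := S.exists_min_image Finset.card hne
  obtain ⟨hC1, hpC⟩ := (hS C).1 hC
  have huniq : ∀ x y, A x y ≠ 0 → x ∈ C → x = p := by
    intro x y hxy hxC
    by_contra hxp
    obtain ⟨D, hD1, h | h⟩ := hsep x y hxy hxp
    · have := Finset.eq_of_subset_of_card_le Finset.inter_subset_left
        (hmin _ ((hS _).2 ⟨hC1.inter hK hA hD1, Finset.mem_inter.2 ⟨hpC, h.1⟩⟩))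
      rw [← this] at hxC
      exact h.2 (Finset.mem_inter.1 hxC).2
    · have := Finset.eq_of_subset_of_card_le Finset.sdiff_subset
        (hmin _ ((hS _).2 ⟨hC1.sdiff hK hA hD1, Finset.mem_sdiff.2 ⟨hpC, h.1⟩⟩))
      rw [← this] at hxC
      exact (Finset.mem_sdiff.1 hxC).2 h.2
  have hfin : A * proj C = Matrix.single p q 1 := by
    ext x y
    rw [mul_proj_apply, Matrix.single_apply]
    by_cases hx : x = p
    · subst hx
      rw [hpq]
      have hq : q ∈ C := (hC1.iff x q (by rw [hpq]; simp)).1 hpC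
      by_cases hy : y = q
      · subst hy; simp [hq]
      · simp [hy, Ne.symm hy]
    · rw [if_neg (c := p = x ∧ q = y) (fun h => hx h.1.symm)]
      by_cases h0 : A x y = 0
      · rw [h0, ite_self]
      · rw [if_neg]
        intro hy
        exact hx (huniq x y h0 ((hC1.iff x y h0).2 hy))
  rw [← hfin]
  exact hC1.good

end Separation

section Star

variable {n d : ℕ}

/-- The hop `|l⟩⟨l-1|_j ⊗ |0⟩⟨1|_a`. -/
def ancHop (n d : ℕ) (j : Fin n) (l : ℕ) : TotOp n d :=
  sysUnit n d j l (l - 1) * ancUnit n d 0 1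

theorem isHop_sysUnit_pred {m : ℕ} (hm : m ∈ Finset.Icc 1 (d - 1)) (i : Fin n) :
    IsHop (sysUnit n d i m (m - 1)) := by
  rw [Finset.mem_Icc] at hm
  exact isHop_sysUnit i (by omega) (by omega) (by omega)

theorem isHop_ancHop {l : ℕ} (hl : l ∈ Finset.Icc 1 (d - 1)) (j : Fin n) :
    IsHop (ancHop n d j l) := by
  unfold ancHop
  constructor <;> simp only [star_mul, mul_assoc,
    (starCommute_sysUnit_ancUnit (n := n) (d := d) j l (l - 1) 0 1).rules,
    (isHop_sysUnit_pred hl j).rules, isHop_ancUnit.rules]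

/-- All the rotations of the elementary hops, between a system and the ancilla and between
neighbouring systems, lie in `K`, and `K` is closed under adjoints. -/
structure HasHops (K : Submonoid (TotOp n d)) : Prop where
  star_mem : ∀ g ∈ K, star g ∈ K
  anc : ∀ j, ∀ l ∈ Finset.Icc 1 (d - 1), Good K (ancHop n d j l)
  sys : ∀ j k : Fin n, (j : ℕ) + 1 = k ∨ (k : ℕ) + 1 = j → ∀ l ∈ Finset.Icc 1 (d - 1),
    ∀ l' ∈ Finset.Icc 1 (d - 1),
      Good K (sysUnit n d j l (l - 1) * star (sysUnit n d k l' (l' - 1)))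

variable {K : Submonoid (TotOp n d)}

/-- A condition on the levels of the systems other than `j` is compatible with the hops of `j`. -/
theorem mem_iff_of_ancHop {j : Fin n} {l : ℕ} (P : Config n d → Prop) [DecidablePred P]
    (hP : ∀ f g : Config n d, (∀ k, k ≠ j → f k = g k) → (P f ↔ P g)) (x y : ConfigA n d)
    (hxy : ancHop n d j l x y ≠ 0) :
    x ∈ Finset.univ.filter (fun x : ConfigA n d => P x.1) ↔
      y ∈ Finset.univ.filter (fun x : ConfigA n d => P x.1) := by
  rw [ancHop, sysUnit_mul_ancUnit_apply] at hxy
  simp only [Finset.mem_filter, Finset.mem_univ, true_and]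
  exact hP _ _ (of_not_not fun h => hxy (if_neg h)).1

/-- The hops between the ancilla and `j` can be conditioned on the level of a neighbour of `j`. -/
theorem isControlSet_neighbour (H : HasHops K) {j k : Fin n}
    (hjk : (j : ℕ) + 1 = k ∨ (k : ℕ) + 1 = j) {l : ℕ} (hl : l ∈ Finset.Icc 1 (d - 1)) {m : ℕ}
    (hm : m < d) : IsControlSet K (ancHop n d j l)
      (Finset.univ.filter fun x : ConfigA n d => (x.1 k : ℕ) = m) := by
  have hne : j ≠ k := by rintro rfl; omega
  have hl' := hl
  rw [Finset.mem_Icc] at hl'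
  refine ⟨mem_iff_of_ancHop (fun f => (f k : ℕ) = m) fun f g h => by simp only [h k hne.symm], ?_⟩
  have key : ∀ l' ∈ Finset.Icc 1 (d - 1),
      Good K (ancHop n d j l * (sysUnit n d k (l' - 1) (l' - 1))) ∧
      Good K (ancHop n d j l * (sysUnit n d k l' l')) := by
    intro l' hl'
    have := good_control H.star_mem (isHop_sysUnit_pred hl j) (isHop_sysUnit_pred hl' k)
      isHop_ancUnit ancUnit_complete (starCommute_sysUnit hne l (l - 1) l' (l' - 1))
      (starCommute_sysUnit_ancUnit j _ _ _ _) (starCommute_sysUnit_ancUnit k _ _ _ _)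
      (H.anc j l hl) (H.anc k l' hl') (H.sys j k hjk l hl l' hl')
    rw [Finset.mem_Icc] at hl'
    rwa [star_sysUnit, sysUnit_mul _ _ _ (by omega), sysUnit_mul _ _ _ (by omega)] at this
  rw [← sysUnit_self]
  by_cases h0 : m = 0
  · have := (key 1 (by rw [Finset.mem_Icc]; omega)).1
    rwa [Nat.sub_self, ← h0] at this
  · exact (key m (by rw [Finset.mem_Icc]; omega)).2

/-- The hops between the ancilla and `j` can be conditioned on a level `m` of a neighbour `k` of `j`
together with the exclusion of a level `r` of another system `v`. One of the two levels is
the lower end of a step between adjacent levels and the other one the upper end of a step, so that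
`m` and `r` must not both be the lowest or both the highest level. -/
theorem isControlSet_pair (H : HasHops K) {j k v : Fin n}
    (hjk : (j : ℕ) + 1 = k ∨ (k : ℕ) + 1 = j) (hvj : v ≠ j) (hvk : v ≠ k) {l : ℕ}
    (hl : l ∈ Finset.Icc 1 (d - 1)) {m r : ℕ} (hm : m < d) (hr : r < d)
    (hmr : (m + 1 < d ∧ 1 ≤ r) ∨ (1 ≤ m ∧ r + 1 < d)) :
    IsControlSet K (ancHop n d j l)
      (Finset.univ.filter fun x : ConfigA n d => (x.1 k : ℕ) = m ∧ (x.1 v : ℕ) ≠ r) := by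
  have hne : j ≠ k := by rintro rfl; omega
  refine ⟨mem_iff_of_ancHop (fun f => (f k : ℕ) = m ∧ (f v : ℕ) ≠ r)
    fun f g h => by simp only [h k hne.symm, h v hvj], ?_⟩
  have e : (proj (Finset.univ.filter fun x : ConfigA n d =>
      (x.1 k : ℕ) = m ∧ (x.1 v : ℕ) ≠ r) : TotOp n d)
      = sysUnit n d k m m * (1 - sysUnit n d v r r) := by
    rw [sysUnit_self, sysUnit_self, one_sub_proj, proj_mul]
    congr 1
    ext x
    simp
  have key : ∀ l' ∈ Finset.Icc 1 (d - 1), ∀ r' ∈ Finset.Icc 1 (d - 1),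
      Good K (ancHop n d j l * sysUnit n d k (l' - 1) (l' - 1) * (1 - sysUnit n d v r' r')) ∧
      Good K (ancHop n d j l * sysUnit n d k l' l' *
        (1 - sysUnit n d v (r' - 1) (r' - 1))) := by
    intro l' hl' r' hr'
    have := good_control_control H.star_mem (isHop_sysUnit_pred hl j) (isHop_sysUnit_pred hl' k)
      (isHop_sysUnit_pred hr' v) isHop_ancUnit ancUnit_complete
      (starCommute_sysUnit hne l (l - 1) l' (l' - 1))
      (starCommute_sysUnit hvj.symm _ _ r' (r' - 1)) (starCommute_sysUnit hvk.symm _ _ _ _)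
      (starCommute_sysUnit_ancUnit j _ _ _ _) (starCommute_sysUnit_ancUnit k _ _ _ _)
      (starCommute_sysUnit_ancUnit v _ _ _ _)
      (H.anc j l hl) (H.anc k l' hl') (H.sys j k hjk l hl l' hl') (H.anc v r' hr')
    rw [Finset.mem_Icc] at hl' hr'
    rwa [star_sysUnit, star_sysUnit, sysUnit_mul _ _ _ (by omega), sysUnit_mul _ _ _ (by omega),
      sysUnit_mul _ _ _ (by omega), sysUnit_mul _ _ _ (by omega)] at this
  rw [e, ← mul_assoc]
  rcases hmr with ⟨c1, c2⟩ | ⟨c1, c2⟩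
  · exact (key (m + 1) (by rw [Finset.mem_Icc]; omega) r (by rw [Finset.mem_Icc]; omega)).1
  · exact (key m (by rw [Finset.mem_Icc]; omega) (r + 1) (by rw [Finset.mem_Icc]; omega)).2

/-- Every single pair of basis vectors that is matched by a hop between a system `j` and the
ancilla can be rotated. The level of a neighbour `k` of `j`, and then that of every other system,
is used to condition the hop. -/
theorem good_pair_of_hop (H : HasHops K) (j : Fin n) (p q : ConfigA n d) (hp : p.2 = 0)
    (hq : q.2 = 1) (hj : (p.1 j : ℕ) = q.1 j + 1) (hne : ∀ k, k ≠ j → p.1 k = q.1 k) :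
    Good K (Matrix.single p q 1) := by
  have hpd := (p.1 j).isLt
  obtain ⟨l, hl⟩ : ∃ l : ℕ, (p.1 j : ℕ) = l := ⟨_, rfl⟩
  have hlI : l ∈ Finset.Icc 1 (d - 1) := Finset.mem_Icc.2 ⟨by omega, by omega⟩
  refine good_single H.star_mem (isHop_ancHop hlI j) (H.anc j l hlI) (p := p) (q := q) ?_ ?_
  · intro y
    rw [ancHop, sysUnit_mul_ancUnit_apply]
    congr 1
    rw [eq_iff_iff]
    constructor
    · rintro ⟨e1, e2, e3, e4, e5⟩
      refine Prod.ext (funext fun k => ?_) (by rw [e5, hq])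
      by_cases hk : k = j
      · subst hk; exact Fin.ext (by omega)
      · rw [← e1 k hk, hne k hk]
    · rintro rfl
      exact ⟨hne, hl, by omega, hp, hq⟩
  · intro x y hxy hxp
    rw [ancHop, sysUnit_mul_ancUnit_apply] at hxy
    obtain ⟨-, e2, -, e4, -⟩ := of_not_not fun h => hxy (if_neg h)
    obtain ⟨v, hv⟩ : ∃ v, x.1 v ≠ p.1 v := by
      by_contra H
      push Not at H
      exact hxp (Prod.ext (funext H) (by rw [e4, hp]))
    have hvj : v ≠ j := by
      rintro rfl
      exact hv (Fin.ext (by omega))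
    have hxv := (x.1 v).isLt
    have hpv := (p.1 v).isLt
    have hv' : (x.1 v : ℕ) ≠ p.1 v := fun h => hv (Fin.ext h)
    obtain ⟨k, hk⟩ : ∃ k : Fin n, (j : ℕ) + 1 = k ∨ (k : ℕ) + 1 = j := by
      have hvj' : (v : ℕ) ≠ j := fun h => hvj (Fin.ext h)
      have := v.isLt
      have := j.isLt
      by_cases hlt : (j : ℕ) + 1 < n
      · exact ⟨⟨j + 1, hlt⟩, Or.inl rfl⟩
      · exact ⟨⟨j - 1, by omega⟩, Or.inr (by simp only; omega)⟩
    have hpk := (p.1 k).isLt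
    by_cases hxk : x.1 k = p.1 k
    swap
    · refine ⟨_, isControlSet_neighbour H hk hlI hpk, Or.inl ⟨by simp, ?_⟩⟩
      simpa using fun h => hxk (Fin.ext h)
    · have hvk : v ≠ k := by rintro rfl; exact hv hxk
      have hsep : ∀ r < d, (r = x.1 v ∨ r = p.1 v) →
          (((p.1 k : ℕ) + 1 < d ∧ 1 ≤ r) ∨ (1 ≤ (p.1 k : ℕ) ∧ r + 1 < d)) →
          ∃ C : Finset (ConfigA n d), IsControlSet K (ancHop n d j l) C ∧
            ((p ∈ C ∧ x ∉ C) ∨ (p ∉ C ∧ x ∈ C)) := by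
        intro r hr hr2 hcase
        refine ⟨_, isControlSet_pair H hk hvj hvk hlI hpk hr hcase, ?_⟩
        simp only [Finset.mem_filter, Finset.mem_univ, true_and, hxk]
        omega
      -- of the two different levels of `v`, at least one can be excluded jointly with the level of `k`
      by_cases c : (p.1 k : ℕ) + 1 < d
      · by_cases c' : (x.1 v : ℕ) = 0
        · exact hsep _ hpv (Or.inr rfl) (by omega)
        · exact hsep _ hxv (Or.inl rfl) (by omega)
      · by_cases c' : (x.1 v : ℕ) + 1 < d
        · exact hsep _ hxv (Or.inl rfl) (by omega)
        · exact hsep _ hpv (Or.inr rfl) (by omega)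

end Star

/-! ### Rotations of arbitrary pairs of basis vectors of the same energy -/

section Pairs

theorem star_single {ι : Type*} [DecidableEq ι] (p q : ι) :
    star (Matrix.single p q (1 : ℂ)) = Matrix.single q p 1 := by
  rw [Matrix.star_eq_conjTranspose, Matrix.conjTranspose_single, star_one]

variable {ι : Type*} [Fintype ι] [DecidableEq ι]

theorem isHop_single {p q : ι} (h : p ≠ q) : IsHop (Matrix.single p q (1 : ℂ)) where
  sq := Matrix.single_mul_single_of_ne _ _ _ _ h.symm _
  iso := by simp [star_single]

/-- The basis vectors `p` and `q` are equal, or their span can be rotated at will. -/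
def Linked (K : Submonoid (Matrix ι ι ℂ)) (p q : ι) : Prop :=
  p = q ∨ Good K (Matrix.single p q 1)

theorem Linked.symm {K : Submonoid (Matrix ι ι ℂ)} {p q : ι} (h : Linked K p q) :
    Linked K q p := by
  rcases h with rfl | h
  · exact Or.inl rfl
  · exact Or.inr (star_single p q ▸ h.adjoint)

theorem Linked.trans {K : Submonoid (Matrix ι ι ℂ)} (hK : ∀ g ∈ K, star g ∈ K) {p q r : ι}
    (h : Linked K p q) (h' : Linked K q r) : Linked K p r := by
  by_cases hpr : p = r
  · exact Or.inl hpr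
  rcases h with rfl | h
  · exact h'
  rcases h' with rfl | h'
  · exact Or.inr h
  by_cases hpq : p = q
  · exact hpq ▸ Or.inr h'
  by_cases hqr : q = r
  · exact hqr ▸ Or.inr h
  refine Or.inr (h'.swap hK h (isHop_single hpq) ?_)
  rw [rot_zero_one, star_single]
  simp only [star_add, star_sub, star_one, Matrix.star_eq_conjTranspose,
    Matrix.conjTranspose_single, mul_add, add_mul, mul_sub, sub_mul, one_mul, mul_one,
    Matrix.single_mul_single_same, Matrix.single_mul_single_of_ne _ _ _ _ hpq,
    Matrix.single_mul_single_of_ne _ _ _ _ (Ne.symm hqr),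
    Matrix.single_mul_single_of_ne _ _ _ _ (Ne.symm hpr), zero_mul]
  abel

variable {n d : ℕ}

/-- The energy of a basis vector of the systems, in units of `ΔE`. -/
def levelSum (r : Config n d) : ℕ := ∑ j, (r j : ℕ)

theorem levelSum_update (r : Config n d) (j : Fin n) (m : Fin d) :
    levelSum (Function.update r j m) + r j = levelSum r + m := by
  unfold levelSum
  rw [← Finset.add_sum_erase _ _ (Finset.mem_univ j),
    ← Finset.add_sum_erase _ _ (Finset.mem_univ j),
    Function.update_self]
  have : ∑ x ∈ Finset.univ.erase j, (Function.update r j m x : ℕ)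
      = ∑ x ∈ Finset.univ.erase j, (r x : ℕ) :=
    Finset.sum_congr rfl fun x hx => by rw [Function.update_of_ne (Finset.ne_of_mem_erase hx)]
  omega

/-- Basis vectors of the same total energy are connected by hops between the systems and the
ancilla: an excitation that is too many moves to the ancilla when the ancilla is empty, and the
ancilla passes its excitation on to a system that lacks one when it is full. -/
theorem linked_of_levelSum_eq {K : Submonoid (TotOp n d)} (H : HasHops K) (x y : ConfigA n d)
    (h : levelSum x.1 + x.2 = levelSum y.1 + y.2) : Linked K x y := by
  have dist_update : ∀ (r : Config n d) (j : Fin n) (m : Fin d),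
      ((m : ℤ) - y.1 j).natAbs < ((r j : ℤ) - y.1 j).natAbs →
      ∑ k, ((Function.update r j m k : ℤ) - y.1 k).natAbs < ∑ k, ((r k : ℤ) - y.1 k).natAbs := by
    intro r j m hm
    refine Finset.sum_lt_sum (fun k _ => ?_) ⟨j, Finset.mem_univ j, by simpa using hm⟩
    by_cases hk : k = j
    · subst hk; simpa using hm.le
    · rw [Function.update_of_ne hk]
  induction hD : ∑ k, ((x.1 k : ℤ) - y.1 k).natAbs using Nat.strong_induction_on generalizing x with
  | _ D ih =>
  obtain ⟨r, b⟩ := x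
  obtain ⟨s, c⟩ := y
  have hc := c.isLt
  simp only at h hD dist_update
  have hcase : b = 0 ∨ b = 1 := by omega
  rcases hcase with rfl | rfl
  · by_cases hj : ∃ j, (s j : ℕ) < r j
    · obtain ⟨j, hj⟩ := hj
      have hrj := (r j).isLt
      have h1 := levelSum_update r j ⟨r j - 1, by omega⟩
      simp only at h1
      have link : Linked K (r, 0) (Function.update r j ⟨r j - 1, by omega⟩, 1) := by
        refine Or.inr (good_pair_of_hop H j _ _ rfl rfl ?_ fun k hk => ?_)
        · simp only [Function.update_self]; omega
        · simp only [Function.update_of_ne hk]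
      refine link.trans H.star_mem (ih _ ?_ _ ?_ rfl)
      · rw [← hD]
        exact dist_update _ _ _ (by simp only; omega)
      · simp only [Fin.val_one, Fin.val_zero] at h ⊢
        omega
    · push Not at hj
      have h1 : ∀ k, (r k : ℕ) = s k := by
        have : levelSum r ≤ levelSum s := Finset.sum_le_sum fun k _ => hj k
        have h0 : levelSum r = levelSum s := by simp only [Fin.val_zero] at h; omega
        exact fun k => (Finset.sum_eq_sum_iff_of_le fun k _ => hj k).1 h0 k (Finset.mem_univ k)
      have h2 : r = s := funext fun k => Fin.ext (h1 k)
      subst h2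
      refine Or.inl (Prod.ext rfl (Fin.ext ?_))
      simp only at h ⊢
      omega
  · by_cases hj : ∃ j, (r j : ℕ) < s j
    · obtain ⟨j, hj⟩ := hj
      have hsj := (s j).isLt
      have h1 := levelSum_update r j ⟨r j + 1, by omega⟩
      simp only at h1
      have link : Linked K (Function.update r j ⟨r j + 1, by omega⟩, 0) (r, 1) := by
        refine Or.inr (good_pair_of_hop H j _ _ rfl rfl ?_ fun k hk => ?_)
        · simp only [Function.update_self]
        · simp only [Function.update_of_ne hk]
      refine link.symm.trans H.star_mem (ih _ ?_ _ ?_ rfl)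
      · rw [← hD]
        exact dist_update _ _ _ (by simp only; omega)
      · simp only [Fin.val_one, Fin.val_zero] at h ⊢
        omega
    · push Not at hj
      have h1 : ∀ k, (s k : ℕ) = r k := by
        have : levelSum s ≤ levelSum r := Finset.sum_le_sum fun k _ => hj k
        have h0 : levelSum s = levelSum r := by simp only [Fin.val_one] at h; omega
        exact fun k => (Finset.sum_eq_sum_iff_of_le fun k _ => hj k).1 h0 k (Finset.mem_univ k)
      have h2 : s = r := funext fun k => Fin.ext (h1 k)
      subst h2
      refine Or.inl (Prod.ext rfl (Fin.ext ?_))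
      simp only at h ⊢
      omega

end Pairs

/-! ### Generating the block-diagonal unitaries by rotations of pairs of basis vectors -/

section Givens

variable {ι : Type*} [Fintype ι]

theorem block_mul {e : ι → ℕ} {g h : Matrix ι ι ℂ} (hg : ∀ w z, e w ≠ e z → g w z = 0)
    (hh : ∀ w z, e w ≠ e z → h w z = 0) (w z : ι) (hwz : e w ≠ e z) : (g * h) w z = 0 := by
  rw [Matrix.mul_apply]
  refine Finset.sum_eq_zero fun u _ => ?_
  by_cases hu : e w = e u
  · rw [hh u z (hu ▸ hwz), mul_zero]
  · rw [hg w u hu, zero_mul]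

variable [DecidableEq ι]

/-- The unitary `z ↦ c z` on the line of the basis vector `x`. -/
def phase (x : ι) (c : ℂ) : Matrix ι ι ℂ := Matrix.diagonal (Function.update 1 x c)

theorem rot_single_apply {x y : ι} (h : x ≠ y) (α β : ℂ) (v : ι → ℂ) (z : ι) :
    (rot (Matrix.single x y 1) α β *ᵥ v) z =
      if z = x then α * v x + β * v y else if z = y then star α * v y - star β * v x else v z := by
  unfold rot
  rw [star_single, Matrix.single_mul_single_same, Matrix.single_mul_single_same, one_mul]
  simp only [Matrix.add_mulVec, Matrix.sub_mulVec, Matrix.smul_mulVec, Matrix.one_mulVec,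
    Matrix.single_mulVec, one_mul, Pi.add_apply, Pi.sub_apply, Pi.smul_apply, smul_eq_mul,
    Function.update_apply, Pi.zero_apply]
  by_cases hx : z = x
  · subst hx; simp [h]; ring
  · by_cases hy : z = y
    · subst hy; simp [hx]; ring
    · simp [hx, hy]

/-- A unitary in `N` that preserves the level sets of `e` and fixes the basis vectors outside
`T`. -/
structure IsMove (N : Submonoid (Matrix ι ι ℂ)) (e : ι → ℕ) (T : Finset ι) (g : Matrix ι ι ℂ) :
    Prop where
  mem : g ∈ N
  star_mul : star g * g = 1
  mul_star : g * star g = 1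
  block : ∀ w z, e w ≠ e z → g w z = 0
  fix : ∀ z ∉ T, ∀ w, g w z = (1 : Matrix ι ι ℂ) w z

variable {N : Submonoid (Matrix ι ι ℂ)} {e : ι → ℕ} {T : Finset ι}

theorem fix_mul {g h : Matrix ι ι ℂ} {z : ι} (hg : ∀ w, g w z = (1 : Matrix ι ι ℂ) w z)
    (hh : ∀ w, h w z = (1 : Matrix ι ι ℂ) w z) (w : ι) :
    (g * h) w z = (1 : Matrix ι ι ℂ) w z := by
  rw [Matrix.mul_apply]
  simp only [hh]
  rw [← Matrix.mul_apply, mul_one, hg]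

theorem IsMove.mul {g h : Matrix ι ι ℂ} (hg : IsMove N e T g) (hh : IsMove N e T h) :
    IsMove N e T (g * h) where
  mem := N.mul_mem hg.mem hh.mem
  star_mul := by rw [StarMul.star_mul, mul_assoc, ← mul_assoc (star g), hg.star_mul, one_mul,
    hh.star_mul]
  mul_star := by rw [StarMul.star_mul, mul_assoc, ← mul_assoc h, hh.mul_star, one_mul, hg.mul_star]
  block := block_mul hg.block hh.block
  fix z hz := fix_mul (hg.fix z hz) (hh.fix z hz)

theorem isMove_phase {x : ι} {c : ℂ} (hc : c * star c = 1) (hN : phase x c ∈ N) (hx : x ∈ T) :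
    IsMove N e T (phase x c) where
  mem := hN
  star_mul := by
    rw [Matrix.star_eq_conjTranspose, phase, Matrix.diagonal_conjTranspose,
      Matrix.diagonal_mul_diagonal, ← Matrix.diagonal_one]
    congr 1
    funext z
    by_cases h : z = x
    · subst h; simpa [mul_comm] using hc
    · simp [h]
  mul_star := by
    rw [Matrix.star_eq_conjTranspose, phase, Matrix.diagonal_conjTranspose,
      Matrix.diagonal_mul_diagonal, ← Matrix.diagonal_one]
    congr 1
    funext z
    by_cases h : z = x
    · subst h; simpa using hc
    · simp [h]
  block w z hwz := Matrix.diagonal_apply_ne _ fun h => hwz (by rw [h])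
  fix z hz w := by
    have : z ≠ x := fun h => hz (h ▸ hx)
    rw [phase, Matrix.diagonal_apply, Matrix.one_apply]
    by_cases h : w = z
    · subst h; simp [this]
    · simp [h]

theorem isMove_rot {x y : ι} (hxy : x ≠ y) (he : e x = e y) {α β : ℂ}
    (hαβ : α * star α + β * star β = 1) (hN : rot (Matrix.single x y 1) α β ∈ N) (hx : x ∈ T)
    (hy : y ∈ T) : IsMove N e T (rot (Matrix.single x y 1) α β) where
  mem := hN
  star_mul := star_mul_rot (isHop_single hxy) hαβ
  mul_star := rot_mul_star (isHop_single hxy) hαβ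
  block w z hwz := by
    have := rot_single_apply hxy α β (Pi.single z 1) w
    rw [Matrix.mulVec_single_one, Matrix.col_apply] at this
    rw [this]
    by_cases h1 : w = x
    · subst h1
      have h2 : w ≠ z := fun h => hwz (by rw [h])
      have h3 : y ≠ z := fun h => hwz (by rw [he, h])
      simp [h2, h3]
    · by_cases h2 : w = y
      · subst h2
        have h2 : w ≠ z := fun h => hwz (by rw [h])
        have h3 : x ≠ z := fun h => hwz (by rw [← he, h])
        simp [h1, h2, h3]
      · have h2 : w ≠ z := fun h => hwz (by rw [h])
        simp_all
  fix z hz w := by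
    have := rot_single_apply hxy α β (Pi.single z 1) w
    rw [Matrix.mulVec_single_one, Matrix.col_apply] at this
    have h2 : x ≠ z := fun h => hz (h ▸ hx)
    have h3 : y ≠ z := fun h => hz (h ▸ hy)
    rw [this, Matrix.one_apply, Pi.single_apply]
    by_cases h1 : w = x
    · subst h1; simp [h2, h3]
    · by_cases h4 : w = y
      · subst h4; simp [h1, h2, h3]
      · simp [h1, h4, Pi.single_apply]

theorem IsMove.norm {g : Matrix ι ι ℂ} (hg : IsMove N e T g) (v : ι → ℂ) :
    star (g *ᵥ v) ⬝ᵥ (g *ᵥ v) = star v ⬝ᵥ v := by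
  rw [Matrix.star_mulVec, ← Matrix.dotProduct_mulVec, Matrix.mulVec_mulVec,
    ← Matrix.star_eq_conjTranspose, hg.star_mul, Matrix.one_mulVec]

/-- A unit vector is carried to the basis vector `x` by Givens rotations, which remove its other
entries one after the other. -/
theorem exists_isMove (h1 : ∀ x y, x ≠ y → e x = e y → Good N (Matrix.single x y 1))
    (h2 : ∀ x c, c * star c = 1 → phase x c ∈ N) {x : ι} (hx : x ∈ T) (s : Finset ι)
    (hs : s ⊆ T) : ∀ v : ι → ℂ, star v ⬝ᵥ v = 1 → (∀ z, z ≠ x → z ∉ s → v z = 0) →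
    (∀ z, v z ≠ 0 → e z = e x) → ∃ g, IsMove N e T g ∧ g *ᵥ v = Pi.single x 1 := by
  induction s using Finset.induction_on with
  | empty =>
    intro v hv hsupp _
    have hvx : v = Pi.single x (v x) := by
      funext z
      by_cases hz : z = x
      · subst hz; simp
      · simp [hz, hsupp z hz]
    have hn : star (v x) * v x = 1 := by
      rw [hvx] at hv
      simpa [dotProduct, Pi.single_apply] using hv
    have hn' : star (v x) * star (star (v x)) = 1 := by rw [star_star, hn]
    refine ⟨phase x (star (v x)), isMove_phase hn' (h2 _ _ hn') hx, ?_⟩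
    funext z
    rw [phase, Matrix.mulVec_diagonal]
    by_cases hz : z = x
    · subst hz; simpa using hn
    · simp [hz, hsupp z hz]
  | insert y s hy ih =>
    intro v hv hsupp hblock
    have ih' := ih fun z hz => hs (Finset.mem_insert_of_mem hz)
    by_cases hyx : y = x
    · subst hyx
      exact ih' v hv (fun z hz hzs => hsupp z hz (by simp [hz, hzs])) hblock
    by_cases hvy : v y = 0
    · refine ih' v hv (fun z hz hzs => ?_) hblock
      by_cases hzy : z = y
      · rw [hzy, hvy]
      · exact hsupp z hz (by simp [hzy, hzs])
    -- the rotation of `x` and `y` that makes the entry at `y` vanish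
    have hpos : 0 < ‖v x‖ ^ 2 + ‖v y‖ ^ 2 := by
      have := norm_pos_iff.2 hvy
      positivity
    obtain ⟨ρ, hρ, hρ2⟩ : ∃ ρ : ℝ, ρ ≠ 0 ∧ ρ ^ 2 = ‖v x‖ ^ 2 + ‖v y‖ ^ 2 :=
      ⟨_, (Real.sqrt_pos.2 hpos).ne', Real.sq_sqrt hpos.le⟩
    have hρ' : (ρ : ℂ) ≠ 0 := by exact_mod_cast hρ
    have hsρ : star (ρ : ℂ) = ρ := Complex.conj_ofReal ρ
    have hsq : v x * star (v x) + v y * star (v y) = (ρ : ℂ) ^ 2 := by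
      rw [show v x * star (v x) = (‖v x‖ : ℂ) ^ 2 from Complex.mul_conj' _,
        show v y * star (v y) = (‖v y‖ : ℂ) ^ 2 from Complex.mul_conj' _]
      exact_mod_cast hρ2.symm
    have hαβ : star (v x) / ρ * star (star (v x) / ρ) + star (v y) / ρ * star (star (v y) / ρ) =
        1 := by
      rw [star_div₀, star_div₀, star_star, star_star, hsρ]
      field_simp
      linear_combination hsq
    have hexy : e x = e y := (hblock y hvy).symm
    have hg := isMove_rot (Ne.symm hyx) hexy hαβ (h1 x y (Ne.symm hyx) hexy _ _ hαβ) hx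
      (hs (Finset.mem_insert_self y s))
    have hap := rot_single_apply (Ne.symm hyx) (star (v x) / ρ) (star (v y) / ρ) v
    have h0 : (rot (Matrix.single x y 1) (star (v x) / ρ) (star (v y) / ρ) *ᵥ v) y = 0 := by
      rw [hap, if_neg hyx, if_pos rfl, star_div₀, star_div₀, star_star, star_star]
      ring
    have key := ih' _ ((hg.norm v).trans hv) (fun z hz hzs => ?_) (fun z hz => ?_)
    · obtain ⟨g, hg', hgv⟩ := key
      exact ⟨_, hg'.mul hg, by rw [← Matrix.mulVec_mulVec, hgv]⟩
    · by_cases hzy : z = y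
      · rw [hzy, h0]
      · rw [hap, if_neg hz, if_neg hzy]
        exact hsupp z hz (by simp [hzy, hzs])
    · by_cases hzx : z = x
      · rw [hzx]
      · by_cases hzy : z = y
        · rw [hzy, hexy]
        · rw [hap, if_neg hzx, if_neg hzy] at hz
          exact hblock z hz

/-- Two-level rotations and phases generate all the unitaries that preserve the level sets of
`e`. -/
theorem mem_of_block (hN : ∀ g ∈ N, star g ∈ N)
    (h1 : ∀ x y, x ≠ y → e x = e y → Good N (Matrix.single x y 1))
    (h2 : ∀ x c, c * star c = 1 → phase x c ∈ N) {V : Matrix ι ι ℂ} (hV : star V * V = 1)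
    (hb : ∀ w z, e w ≠ e z → V w z = 0) : V ∈ N := by
  suffices H : ∀ (s : Finset ι) (V : Matrix ι ι ℂ), star V * V = 1 →
      (∀ w z, e w ≠ e z → V w z = 0) → (∀ z ∉ s, ∀ w, V w z = (1 : Matrix ι ι ℂ) w z) → V ∈ N from
    H Finset.univ V hV hb (by simp)
  intro s
  induction s using Finset.induction_on with
  | empty =>
    intro V _ _ hfix
    rw [show V = 1 from Matrix.ext fun w z => hfix z (Finset.notMem_empty z) w]
    exact N.one_mem
  | insert x s hx ih =>
    intro V hV hb hfix
    have hent : ∀ z w, ∑ u, star (V u z) * V u w = (1 : Matrix ι ι ℂ) z w := by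
      intro z w
      rw [← hV, Matrix.mul_apply]
      rfl
    have key := exists_isMove (T := insert x s) h1 h2 (Finset.mem_insert_self x s) s
      (Finset.subset_insert x s) (fun w => V w x) ?_ ?_ ?_
    · obtain ⟨g, hg, hgv⟩ := key
      have hmem : g * V ∈ N := by
        refine ih _ ?_ (block_mul hg.block hb) fun z hz => ?_
        · rw [star_mul, mul_assoc, ← mul_assoc (star g), hg.star_mul, one_mul, hV]
        · by_cases hzx : z = x
          · subst hzx
            intro w
            have := congrFun hgv w
            rw [Matrix.one_apply, Matrix.mul_apply]
            simpa [Matrix.mulVec, dotProduct, Pi.single_apply] using this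
          · have hz' : z ∉ insert x s := by simp [hz, hzx]
            exact fix_mul (hg.fix z hz') (hfix z hz')
      have := N.mul_mem (hN g hg.mem) hmem
      rwa [← mul_assoc, hg.star_mul, one_mul] at this
    · simpa [dotProduct] using hent x x
    · intro z hz hzs
      have h := hent z x
      have hz' : z ∉ insert x s := by simp [hz, hzs]
      simp only [hfix z hz', Matrix.one_apply] at h
      simpa [hz] using h
    · intro z hz
      by_contra hne
      exact hz (hb z x hne)

end Givens

/-! ### The gates -/

theorem IsHop.add_star_cube {𝒜 : Type*} [Ring 𝒜] [StarRing 𝒜] {A : 𝒜} (hA : IsHop A) :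
    (star A + A) * (star A + A) * (star A + A) = star A + A := by
  simp only [mul_add, add_mul, mul_assoc, hA.rules, mul_zero, add_zero, zero_add]

section Exponential

theorem exists_arg {c : ℂ} (hc : c * star c = 1) :
    ∃ θ : ℝ, c = Complex.exp (θ * Complex.I) := by
  have hn : ‖c‖ = 1 := by
    have h1 : (‖c‖ : ℂ) ^ 2 = 1 := by rw [← hc]; exact (Complex.mul_conj' c).symm
    have h2 : ‖c‖ ^ 2 = 1 := by exact_mod_cast h1
    nlinarith [norm_nonneg c]
  have := Complex.norm_mul_exp_arg_mul_I c
  rw [hn, Complex.ofReal_one, one_mul] at this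
  exact ⟨c.arg, this.symm⟩

/-- The exponential `exp(iθA)` of an operator with `A ^ 3 = A`, see `exp_eq_gate`. -/
noncomputable def gate {𝒜 : Type*} [Ring 𝒜] [Algebra ℂ 𝒜] (A : 𝒜) (θ : ℝ) : 𝒜 :=
  1 + (Complex.I * Real.sin θ) • A + ((Real.cos θ : ℂ) - 1) • (A * A)

open NormedSpace in
theorem exp_eq_gate {𝒜 : Type*} [Ring 𝒜] [Algebra ℂ 𝒜] [TopologicalSpace 𝒜]
    [IsTopologicalRing 𝒜] [ContinuousSMul ℂ 𝒜] [T2Space 𝒜] {A : 𝒜} (hA : A * A * A = A) (θ : ℝ) :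
    exp ((Complex.I * (θ : ℂ)) • A) = gate A θ := by
  -- the spectral projections of `A` for the eigenvalues `1` and `-1`
  obtain ⟨P, hP⟩ : ∃ P : 𝒜, P = (2⁻¹ : ℂ) • (A * A + A) := ⟨_, rfl⟩
  obtain ⟨M, hM⟩ : ∃ M : 𝒜, M = (2⁻¹ : ℂ) • (A * A - A) := ⟨_, rfl⟩
  have hAP : P * A = P := by rw [hP, smul_mul_assoc, add_mul, hA, add_comm]
  have hAM : M * A = -M := by rw [hM, smul_mul_assoc, sub_mul, hA]; module
  have hpow : ∀ n : ℕ, A ^ (n + 1) = P + ((-1 : ℂ) ^ (n + 1)) • M := by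
    intro n
    induction n with
    | zero => rw [hP, hM]; simp; module
    | succ n ih =>
      rw [pow_succ, ih, add_mul, hAP, smul_mul_assoc, hAM, pow_succ _ (n + 1)]
      module
  have h1 : HasSum (fun n : ℕ => ((n.factorial : ℂ)⁻¹ • (Complex.I * θ) ^ n) • P)
      (exp (Complex.I * (θ : ℂ)) • P) := (exp_series_hasSum_exp' (𝕂 := ℂ) _).smul_const P
  have h2 : HasSum (fun n : ℕ => ((n.factorial : ℂ)⁻¹ • (-(Complex.I * θ)) ^ n) • M)
      (exp (-(Complex.I * (θ : ℂ))) • M) := (exp_series_hasSum_exp' (𝕂 := ℂ) _).smul_const M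
  have h3 : HasSum (fun n : ℕ => if n = 0 then 1 - P - M else 0) (1 - P - M) :=
    hasSum_ite_eq 0 _
  have h4 : (fun n : ℕ => (n.factorial : ℂ)⁻¹ • ((Complex.I * (θ : ℂ)) • A) ^ n) =
      fun n => (((n.factorial : ℂ)⁻¹ • (Complex.I * θ) ^ n) • P +
        ((n.factorial : ℂ)⁻¹ • (-(Complex.I * θ)) ^ n) • M) +
        if n = 0 then 1 - P - M else 0 := by
    funext n
    rcases n with _ | n
    · simp
    · rw [smul_pow, hpow, if_neg (Nat.succ_ne_zero n), add_zero, neg_pow (Complex.I * (θ : ℂ))]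
      simp only [smul_eq_mul]
      module
  rw [exp_eq_tsum ℂ]
  simp only
  rw [h4, ((h1.add h2).add h3).tsum_eq, ← Complex.exp_eq_exp_ℂ]
  have e1 : Complex.exp (Complex.I * θ) = Real.cos θ + Real.sin θ * Complex.I := by
    rw [mul_comm, Complex.exp_mul_I, Complex.ofReal_cos, Complex.ofReal_sin]
  have e2 : Complex.exp (-(Complex.I * θ)) = Real.cos θ - Real.sin θ * Complex.I := by
    rw [show -(Complex.I * (θ : ℂ)) = (-θ : ℂ) * Complex.I by ring, Complex.exp_mul_I,
      Complex.cos_neg, Complex.sin_neg, Complex.ofReal_cos, Complex.ofReal_sin]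
    ring
  rw [e1, e2, hP, hM, gate]
  module

section

variable {𝒜 : Type*} [Ring 𝒜] [Algebra ℂ 𝒜]

theorem gate_mul {A : 𝒜} (hA : A * A * A = A) (θ φ : ℝ) :
    gate A θ * gate A φ = gate A (θ + φ) := by
  have h4 : A * A * (A * A) = A * A := by rw [← mul_assoc, hA]
  have h3 : A * (A * A) = A := by rw [← mul_assoc, hA]
  unfold gate
  rw [Real.sin_add, Real.cos_add]
  simp only [mul_add, add_mul, one_mul, mul_one, smul_mul_smul_comm, h3, h4, hA]
  rw [Complex.ofReal_add, Complex.ofReal_sub, Complex.ofReal_mul, Complex.ofReal_mul,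
    Complex.ofReal_mul, Complex.ofReal_mul]
  match_scalars
  · ring
  · ring
  · linear_combination (Complex.sin θ * Complex.sin φ) * Complex.I_mul_I

theorem gate_zero (A : 𝒜) : gate A 0 = 1 := by simp [gate]

theorem gate_congr (A : 𝒜) {θ φ : ℝ} (h : ∃ k : ℤ, θ = φ + k * (2 * Real.pi)) :
    gate A θ = gate A φ := by
  obtain ⟨k, rfl⟩ := h
  rw [gate, Real.sin_add_int_mul_two_pi, Real.cos_add_int_mul_two_pi, gate]

variable [StarRing 𝒜]

theorem gate_add_star (A : 𝒜) (hA : IsHop A) (θ : ℝ) :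
    gate (star A + A) θ = rot A (Real.cos θ : ℂ) (Complex.I * Real.sin θ) := by
  unfold gate rot
  simp only [mul_add, add_mul, hA.sq, hA.star_sq, star_mul',
    show star Complex.I = -Complex.I from Complex.conj_I,
    show ∀ r : ℝ, star (r : ℂ) = r from Complex.conj_ofReal]
  module

variable [StarModule ℂ 𝒜]

theorem star_gate {A : 𝒜} (hA : star A = A) (θ : ℝ) : star (gate A θ) = gate A (-θ) := by
  unfold gate
  simp only [star_add, star_one, star_smul, star_mul, hA, star_sub, Real.cos_neg,
    Real.sin_neg, Complex.ofReal_neg, show star Complex.I = -Complex.I from Complex.conj_I,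
    show ∀ r : ℝ, star (r : ℂ) = r from Complex.conj_ofReal]
  module

/-- A hop is good if the rotations about one axis and all the phases are available. -/
theorem good_of_gate {K : Submonoid 𝒜} (hK : ∀ g ∈ K, star g ∈ K) {A : 𝒜} (hA : IsHop A)
    (h : ∀ θ, gate (star A + A) θ ∈ K)
    (h' : ∀ c : ℂ, c * star c = 1 → ∃ W ∈ K, star W * W = 1 ∧ W * star W = 1 ∧
      W * A * star W = c • A) : Good K A := by
  refine good_of_phases hA fun θ c hc => ?_
  obtain ⟨W, hW, h1, h2, h3⟩ := h' c hc
  rw [← h3, ← conj_rot h1 h2, ← gate_add_star A hA]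
  exact K.mul_mem (K.mul_mem hW (h θ)) (hK W hW)

end

end Exponential

section Gates

variable {n d : ℕ}

theorem Rja_eq (j : Fin n) (l : ℕ) : Rja d j l = star (ancHop n d j l) + ancHop n d j l := by
  rw [ancHop, star_mul, star_sysUnit, star_ancUnit, sysUnit, sysUnit, ancUnit, ancUnit,
    onAncilla_mul_liftSys, Rja]

theorem Rjk_eq {j k : Fin n} (h : j ≠ k) (l l' : ℕ) :
    Rjk d j k l l' = star (sysUnit n d j l (l - 1) * star (sysUnit n d k l' (l' - 1))) +
      sysUnit n d j l (l - 1) * star (sysUnit n d k l' (l' - 1)) := by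
  rw [star_mul, star_sysUnit, star_sysUnit, star_sysUnit, (starCommute_sysUnit h _ _ _ _).comm,
    sysUnit, sysUnit, sysUnit, sysUnit, liftSys_mul, liftSys_mul, Rjk]

theorem isHop_exchange {j k : Fin n} (h : j ≠ k) {l l' : ℕ} (hl : l ∈ Finset.Icc 1 (d - 1))
    (hl' : l' ∈ Finset.Icc 1 (d - 1)) :
    IsHop (sysUnit n d j l (l - 1) * star (sysUnit n d k l' (l' - 1))) := by
  constructor <;> simp only [star_mul, star_star, mul_assoc,
    (starCommute_sysUnit (d := d) h l (l - 1) l' (l' - 1)).rules,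
    (isHop_sysUnit_pred hl j).rules, (isHop_sysUnit_pred hl' k).rules]

theorem star_Za : star (Za n d) = Za n d := by
  rw [Matrix.star_eq_conjTranspose, Za, conjTranspose_onAncilla]
  congr 1
  ext i k
  fin_cases i <;> fin_cases k <;> simp [pauliZ]

theorem Za_mul_Za : Za n d * Za n d = 1 := by
  rw [Za, onAncilla_mul, show pauliZ * pauliZ = 1 by
    ext i k; fin_cases i <;> fin_cases k <;> simp [pauliZ], onAncilla, Matrix.one_kronecker_one]

theorem Za_mul_ancUnit : Za n d * ancUnit n d 0 1 = ancUnit n d 0 1 := by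
  rw [Za, ancUnit, onAncilla_mul, show pauliZ * ketBra 2 0 1 = ketBra 2 0 1 by
    ext i k; fin_cases i <;> fin_cases k <;> simp [pauliZ, ketBra, Matrix.mul_apply]]

theorem ancUnit_mul_Za : ancUnit n d 0 1 * Za n d = -ancUnit n d 0 1 := by
  rw [Za, ancUnit, onAncilla_mul, show ketBra 2 0 1 * pauliZ = -ketBra 2 0 1 by
    ext i k; fin_cases i <;> fin_cases k <;> simp [pauliZ, ketBra, Matrix.mul_apply]]
  ext x y
  simp [onAncilla, Matrix.kroneckerMap_apply]

theorem ne_of_succ_eq {j k : Fin n} (h : (j : ℕ) + 1 = k) : j ≠ k := by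
  rintro rfl; omega

theorem IsInteraction.star_eq {A : TotOp n d} (h : IsInteraction n d A) : star A = A := by
  rcases h with _ | ⟨j, l, hl⟩ | ⟨j, k, hjk, l, l', hl, hl'⟩
  · exact star_Za
  · rw [Rja_eq, star_add, star_star, add_comm]
  · rw [Rjk_eq (ne_of_succ_eq hjk), star_add, star_star, add_comm]

theorem IsInteraction.cube {A : TotOp n d} (h : IsInteraction n d A) : A * A * A = A := by
  rcases h with _ | ⟨j, l, hl⟩ | ⟨j, k, hjk, l, l', hl, hl'⟩
  · rw [Za_mul_Za, one_mul]
  · rw [Rja_eq]; exact (isHop_ancHop hl j).add_star_cube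
  · rw [Rjk_eq (ne_of_succ_eq hjk)]
    exact (isHop_exchange (ne_of_succ_eq hjk) hl hl').add_star_cube

theorem isGate_iff {G : TotOp n d} :
    IsGate n d G ↔ ∃ A, IsInteraction n d A ∧ ∃ θ : ℝ, G = gate A θ := by
  constructor
  · rintro ⟨A, hA, θ, -, rfl⟩
    exact ⟨A, hA, θ, exp_eq_gate hA.cube θ⟩
  · rintro ⟨A, hA, θ, rfl⟩
    refine ⟨A, hA, toIcoMod Real.two_pi_pos 0 θ, ?_, ?_⟩
    · have := toIcoMod_mem_Ico Real.two_pi_pos 0 θ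
      rwa [zero_add] at this
    · rw [exp_eq_gate hA.cube]
      refine gate_congr A ⟨toIcoDiv Real.two_pi_pos 0 θ, ?_⟩
      have := toIcoMod_add_toIcoDiv_zsmul Real.two_pi_pos 0 θ
      rw [zsmul_eq_mul] at this
      exact this.symm

/-- The operators that are finite products of gates. -/
def gateMonoid (n d : ℕ) : Submonoid (TotOp n d) := Submonoid.closure {G | IsGate n d G}

theorem gate_mem {A : TotOp n d} (hA : IsInteraction n d A) (θ : ℝ) :
    gate A θ ∈ gateMonoid n d :=
  Submonoid.subset_closure (isGate_iff.2 ⟨A, hA, θ, rfl⟩)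

theorem star_mem_gateMonoid : ∀ g ∈ gateMonoid n d, star g ∈ gateMonoid n d := by
  intro g hg
  induction hg using Submonoid.closure_induction with
  | mem x hx =>
    obtain ⟨A, hA, θ, rfl⟩ := isGate_iff.1 hx
    rw [star_gate hA.star_eq]
    exact gate_mem hA _
  | one => rw [star_one]; exact one_mem _
  | mul x y _ _ hx hy => rw [star_mul]; exact mul_mem hy hx

theorem IsInteraction.gate_mul_star {A : TotOp n d} (hA : IsInteraction n d A) (θ : ℝ) :
    gate A θ * star (gate A θ) = 1 := by
  rw [star_gate hA.star_eq, gate_mul hA.cube, add_neg_cancel, gate_zero]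

theorem IsInteraction.star_mul_gate {A : TotOp n d} (hA : IsInteraction n d A) (θ : ℝ) :
    star (gate A θ) * gate A θ = 1 := by
  rw [star_gate hA.star_eq, gate_mul hA.cube, neg_add_cancel, gate_zero]

/-- The gates `exp(iθ Z_a)` change the phases of the hops to the ancilla. -/
theorem conj_gate_Za (j : Fin n) (l : ℕ) (θ : ℝ) :
    gate (Za n d) θ * ancHop n d j l * star (gate (Za n d) θ)
      = Complex.exp (2 * θ * Complex.I) • ancHop n d j l := by
  have e : Complex.exp (2 * θ * Complex.I) =
      (Real.cos θ + Complex.I * Real.sin θ) * (Real.cos θ + Complex.I * Real.sin θ) := by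
    rw [show (2 * θ * Complex.I : ℂ) = θ * Complex.I + θ * Complex.I by ring, Complex.exp_add,
      Complex.exp_mul_I, Complex.ofReal_cos, Complex.ofReal_sin]
    ring
  have h1 : Za n d * ancHop n d j l = ancHop n d j l := by
    rw [ancHop, ← mul_assoc, Za, sysUnit, onAncilla_mul_liftSys, mul_assoc, ← Za, Za_mul_ancUnit]
  have h2 : ancHop n d j l * Za n d = -ancHop n d j l := by
    rw [ancHop, mul_assoc, ancUnit_mul_Za, mul_neg]
  have h3 : gate (Za n d) θ * ancHop n d j l
      = (Real.cos θ + Complex.I * Real.sin θ) • ancHop n d j l := by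
    rw [gate, Za_mul_Za, add_mul, add_mul, smul_mul_assoc, smul_mul_assoc, h1, one_mul]
    module
  have h4 : ancHop n d j l * star (gate (Za n d) θ)
      = (Real.cos θ + Complex.I * Real.sin θ) • ancHop n d j l := by
    rw [star_gate star_Za, gate, Za_mul_Za, mul_add, mul_add, mul_smul_comm, mul_smul_comm, h2,
      mul_one, Real.sin_neg, Real.cos_neg]
    push_cast
    module
  rw [h3, smul_mul_assoc, h4, smul_smul, e]

/-- The elementary hops are obtained from the gates, all phases included. -/
theorem hasHops_gateMonoid : HasHops (gateMonoid n d) := by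
  have hanc : ∀ j, ∀ l ∈ Finset.Icc 1 (d - 1), Good (gateMonoid n d) (ancHop n d j l) := by
    intro j l hl
    refine good_of_gate star_mem_gateMonoid (isHop_ancHop hl j) (fun θ => ?_) fun c hc => ?_
    · rw [← Rja_eq]
      exact gate_mem (.sysAnc j l hl) θ
    · obtain ⟨φ, rfl⟩ := exists_arg hc
      refine ⟨gate (Za n d) (φ / 2), gate_mem .anc _, IsInteraction.anc.star_mul_gate _,
        IsInteraction.anc.gate_mul_star _, ?_⟩
      rw [conj_gate_Za, Complex.ofReal_div, Complex.ofReal_ofNat, mul_div_cancel₀ _ two_ne_zero]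
  have hsys : ∀ j k : Fin n, (j : ℕ) + 1 = k → ∀ l ∈ Finset.Icc 1 (d - 1),
      ∀ l' ∈ Finset.Icc 1 (d - 1), Good (gateMonoid n d)
        (sysUnit n d j l (l - 1) * star (sysUnit n d k l' (l' - 1))) := by
    intro j k hjk l hl l' hl'
    have hne := ne_of_succ_eq hjk
    refine good_of_gate star_mem_gateMonoid (isHop_exchange hne hl hl') (fun θ => ?_)
      fun c hc => ?_
    · rw [← Rjk_eq hne]
      exact gate_mem (.sysSys j k hjk l l' hl hl') θ
    · have hc' : c * star c + 0 * star 0 = 1 := by simpa using hc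
      exact ⟨_, hanc j l hl c 0 hc', star_mul_rot (isHop_ancHop hl j) hc',
        rot_mul_star (isHop_ancHop hl j) hc', conj_phase_exchange (isHop_sysUnit_pred hl j)
          isHop_ancUnit ancUnit_complete (starCommute_sysUnit hne _ _ _ _)
          (starCommute_sysUnit_ancUnit j _ _ _ _) (starCommute_sysUnit_ancUnit k _ _ _ _) c⟩
  refine ⟨star_mem_gateMonoid, hanc, fun j k hjk l hl l' hl' => ?_⟩
  rcases hjk with hjk | hjk
  · exact hsys j k hjk l hl l' hl'
  · have := (hsys k j hjk l' hl' l hl).adjoint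
    rwa [star_mul, star_star] at this

end Gates

/-! ### The unitaries implemented with the help of the ancilla -/

section Embedding

variable {n d : ℕ}

/-- The isometry `|ψ⟩ ↦ |ψ⟩ ⊗ |0⟩_a`. -/
def emb (n d : ℕ) : Matrix (ConfigA n d) (Config n d) ℂ :=
  Matrix.of fun x r => if x = (r, 0) then 1 else 0

theorem mul_emb_apply (W : TotOp n d) (x : ConfigA n d) (r : Config n d) :
    (W * emb n d) x r = W x (r, 0) := by
  rw [Matrix.mul_apply]
  simp [emb]

theorem emb_mul_apply (V : SysOp n d) (x : ConfigA n d) (r : Config n d) :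
    (emb n d * V) x r = if x.2 = 0 then V x.1 r else 0 := by
  rw [Matrix.mul_apply]
  obtain ⟨s, b⟩ := x
  by_cases h : b = 0
  · simp [emb, h]
  · simp [emb, h]

theorem emb_mulVec (ψ : Config n d → ℂ) : emb n d *ᵥ ψ = withAncilla ψ := by
  funext x
  obtain ⟨s, b⟩ := x
  by_cases h : b = 0 <;> simp [Matrix.mulVec, dotProduct, emb, withAncilla, h]

theorem single_mul_emb (p : ConfigA n d) (y : Config n d) (x : Config n d) (hp : p = (x, 0)) :
    (Matrix.single p (y, 0) 1 : TotOp n d) * emb n d =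
      emb n d * (Matrix.single x y 1 : SysOp n d) := by
  subst hp
  ext z r
  rw [mul_emb_apply, emb_mul_apply, Matrix.single_apply, Matrix.single_apply]
  obtain ⟨s, b⟩ := z
  by_cases hb : b = 0
  · subst hb; simp
  · simp [hb, Ne.symm hb]

theorem single_one_mul_emb (p : ConfigA n d) (y : Config n d) :
    (Matrix.single p (y, 1) 1 : TotOp n d) * emb n d = 0 := by
  ext z r
  rw [mul_emb_apply, Matrix.single_apply]
  simp

/-- The operators `V` on the systems such that some `W` in `K` acts as `V` while the ancilla is
in the state `|0⟩`, and the adjoint of `W` as the adjoint of `V`. -/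
def assisted (K : Submonoid (TotOp n d)) : Submonoid (SysOp n d) where
  carrier := {V | ∃ W ∈ K, W * emb n d = emb n d * V ∧ star W * emb n d = emb n d * star V}
  one_mem' := ⟨1, K.one_mem, by simp, by simp⟩
  mul_mem' := by
    rintro V V' ⟨W, hW, h1, h2⟩ ⟨W', hW', h1', h2'⟩
    refine ⟨W * W', K.mul_mem hW hW', ?_, ?_⟩
    · rw [Matrix.mul_assoc, h1', ← Matrix.mul_assoc, h1, Matrix.mul_assoc]
    · rw [star_mul, star_mul, Matrix.mul_assoc, h2, ← Matrix.mul_assoc, h2', Matrix.mul_assoc]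

variable {K : Submonoid (TotOp n d)}

theorem star_mem_assisted (hK : ∀ g ∈ K, star g ∈ K) :
    ∀ V ∈ assisted K, star V ∈ assisted K := by
  rintro V ⟨W, hW, h1, h2⟩
  exact ⟨star W, hK W hW, h2, by simpa using h1⟩

theorem phase_eq {ι : Type*} [Fintype ι] [DecidableEq ι] (x : ι) (c : ℂ) :
    phase x c = 1 + (c - 1) • Matrix.single x x 1 := by
  ext w z
  rw [phase, Matrix.diagonal_apply, Matrix.add_apply, Matrix.smul_apply, Matrix.single_apply,
    Matrix.one_apply]
  by_cases h : w = z
  · subst h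
    by_cases hx : w = x
    · subst hx; simp
    · simp [hx, Ne.symm hx]
  · have : ¬ (x = w ∧ x = z) := fun h' => h (h'.1.symm.trans h'.2)
    simp [h, this]

theorem star_phase {ι : Type*} [Fintype ι] [DecidableEq ι] (x : ι) (c : ℂ) :
    star (phase x c) = phase x (star c) := by
  rw [phase_eq, phase_eq, star_add, star_smul, star_single, star_sub, star_one, star_one]

theorem good_assisted (H : HasHops K) {x y : Config n d} (hxy : x ≠ y)
    (h : levelSum x = levelSum y) : Good (assisted K) (Matrix.single x y 1) := by
  have hne : ((x, 0) : ConfigA n d) ≠ (y, 0) := fun h => hxy (congrArg Prod.fst h)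
  have hgood := (linked_of_levelSum_eq H (x, 0) (y, 0) (by simp [h])).resolve_left hne
  have key : ∀ α β : ℂ,
      rot (Matrix.single (x, 0) (y, 0) 1 : TotOp n d) α β * emb n d =
        emb n d * rot (Matrix.single x y 1 : SysOp n d) α β := by
    intro α β
    unfold rot
    simp only [star_single, Matrix.single_mul_single_same, Matrix.add_mul, Matrix.sub_mul,
      Matrix.mul_add, Matrix.mul_sub, Matrix.smul_mul, Matrix.mul_smul, one_mul,
      single_mul_emb _ _ _ rfl, Matrix.one_mul, Matrix.mul_one]
  intro α β hαβ
  refine ⟨_, hgood α β hαβ, key α β, ?_⟩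
  rw [star_rot, star_rot, key]

/-- The phase of an excited basis vector is adjusted by a rotation that shifts the opposite phase
to a basis vector with the ancilla in the state `|1⟩`. -/
theorem phase_mem_of_pos (H : HasHops K) {x : Config n d} (hx : levelSum x ≠ 0) {c : ℂ}
    (hc : c * star c = 1) : phase x c ∈ assisted K := by
  obtain ⟨j, hj⟩ : ∃ j, (x j : ℕ) ≠ 0 := by
    by_contra h
    push Not at h
    exact hx (Finset.sum_eq_zero fun j _ => h j)
  have hxj := (x j).isLt
  have h1 := levelSum_update x j ⟨x j - 1, by omega⟩
  obtain ⟨y, hy⟩ : ∃ y, y = Function.update x j ⟨x j - 1, by omega⟩ := ⟨_, rfl⟩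
  rw [← hy] at h1
  have hne : ((x, 0) : ConfigA n d) ≠ (y, 1) := fun h => zero_ne_one (congrArg Prod.snd h)
  have hgood := (linked_of_levelSum_eq H (x, 0) (y, 1)
    (by simp only [Fin.val_zero, Fin.val_one] at h1 ⊢; omega)).resolve_left hne
  have key : ∀ c : ℂ, rot (Matrix.single (x, 0) (y, 1) 1 : TotOp n d) c 0 * emb n d =
      emb n d * phase x c := by
    intro c
    rw [phase_eq]
    unfold rot
    simp only [star_single, Matrix.single_mul_single_same, Matrix.add_mul,
      Matrix.mul_add, Matrix.smul_mul, Matrix.mul_smul, one_mul, star_zero, zero_smul,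
      single_mul_emb _ _ _ rfl, single_one_mul_emb, Matrix.one_mul, Matrix.mul_one, smul_zero,
      add_zero, sub_zero]
  refine ⟨_, hgood c 0 (by simpa using hc), key c, ?_⟩
  rw [star_rot, star_phase, neg_zero, key]

theorem Za_mul_emb : Za n d * emb n d = emb n d := by
  ext x r
  rw [mul_emb_apply, Za, onAncilla, Matrix.kroneckerMap_apply, emb, Matrix.of_apply]
  obtain ⟨s, b⟩ := x
  fin_cases b <;> simp [pauliZ, Matrix.one_apply, Prod.ext_iff]

/-- The gates `exp(iθ Z_a)` implement the global phases. -/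
theorem smul_one_mem {c : ℂ} (hc : c * star c = 1) :
    (c • 1 : SysOp n d) ∈ assisted (gateMonoid n d) := by
  obtain ⟨θ, rfl⟩ := exists_arg hc
  have key : ∀ θ : ℝ, gate (Za n d) θ * emb n d =
      emb n d * (Complex.exp (θ * Complex.I) • (1 : SysOp n d)) := by
    intro θ
    rw [gate, Za_mul_Za, Matrix.add_mul, Matrix.add_mul, Matrix.smul_mul, Matrix.smul_mul,
      Matrix.one_mul, Za_mul_emb, Matrix.mul_smul, Matrix.mul_one, Complex.exp_mul_I,
      Complex.ofReal_cos, Complex.ofReal_sin]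
    module
  refine ⟨_, gate_mem .anc θ, key θ, ?_⟩
  rw [star_gate star_Za, key, star_smul, star_one,
    show star (Complex.exp (θ * Complex.I)) = _ from (Complex.exp_conj _).symm, map_mul,
    Complex.conj_I, Complex.conj_ofReal, Complex.ofReal_neg, neg_mul, mul_neg]

theorem phase_mem (x : Config n d) {c : ℂ} (hc : c * star c = 1) :
    phase x c ∈ assisted (gateMonoid n d) := by
  by_cases hx : levelSum x = 0
  swap
  · exact phase_mem_of_pos hasHops_gateMonoid hx hc
  -- the phase of the ground state is a global phase, undone on all the other basis vectors
  have hc' : star c * star (star c) = 1 := by rw [star_star, mul_comm, hc]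
  have hs : ∀ s : Finset (Config n d), x ∉ s →
      Matrix.diagonal (fun z => if z ∈ s then star c else 1) ∈ assisted (gateMonoid n d) := by
    intro s
    induction s using Finset.induction_on with
    | empty => intro _; simp
    | insert y s hy ih =>
      intro hxs
      rw [Finset.mem_insert, not_or] at hxs
      have hy0 : levelSum y ≠ 0 := by
        intro hy0
        refine hxs.1 (funext fun j => Fin.ext ?_)
        rw [Finset.sum_eq_zero_iff.1 hx j (Finset.mem_univ j),
          Finset.sum_eq_zero_iff.1 hy0 j (Finset.mem_univ j)]
      have := mul_mem (phase_mem_of_pos hasHops_gateMonoid hy0 hc') (ih hxs.2)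
      rw [phase, Matrix.diagonal_mul_diagonal] at this
      refine (congrArg (· ∈ assisted (gateMonoid n d))
        (congrArg Matrix.diagonal (funext fun z => ?_))).mp this
      by_cases hzy : z = y
      · subst hzy; simp [hy]
      · simp [hzy]
  have := mul_mem (smul_one_mem hc) (hs (Finset.univ.erase x) (by simp))
  rw [Matrix.smul_mul, Matrix.one_mul, ← Matrix.diagonal_smul] at this
  convert this using 2
  rw [phase]
  congr 1
  funext z
  by_cases hz : z = x
  · subst hz; simp
  · simp only [Function.update_of_ne hz, Pi.smul_apply, Finset.mem_erase, Finset.mem_univ]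
    simpa [hz] using hc.symm

theorem intrinsicHam_eq (ΔE : ℝ) : intrinsicHam n d ΔE =
    Matrix.diagonal fun r : Config n d => (ΔE : ℂ) * levelSum r := by
  have h1 : singleHam d ΔE = Matrix.diagonal fun r : Fin d => (ΔE : ℂ) * r := by
    ext i k
    rw [singleHam, Matrix.smul_apply, Matrix.sum_apply, Matrix.diagonal_apply]
    simp only [Matrix.smul_apply, ketBra, Matrix.of_apply, smul_eq_mul]
    by_cases h : i = k
    · subst h
      rw [if_pos rfl, Finset.sum_eq_single (i : ℕ)]
      · simp
      · intro r _ hr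
        simp [Ne.symm hr]
      · simp
    · rw [if_neg h, Finset.sum_eq_zero, mul_zero]
      intro r _
      rw [if_neg, mul_zero]
      exact fun h' => h (Fin.ext (h'.1.trans h'.2.symm))
  have h2 : ∀ j : Fin n, onSystem j (singleHam d ΔE) =
      Matrix.diagonal fun r : Config n d => (ΔE : ℂ) * (r j : ℕ) := by
    intro j
    ext r s
    rw [h1, onSystem, Matrix.of_apply, Matrix.diagonal_apply, Matrix.diagonal_apply]
    by_cases h : r = s
    · subst h; simp
    · rw [if_neg h]
      split_ifs with h3 h4
      · refine absurd (funext fun k => ?_) h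
        by_cases hk : k = j
        · subst hk; exact h4
        · exact h3 k hk
      all_goals rfl
  ext r s
  rw [intrinsicHam, Matrix.sum_apply, Matrix.diagonal_apply]
  simp only [h2, Matrix.diagonal_apply]
  split_ifs with h
  · rw [levelSum, Nat.cast_sum, Finset.mul_sum]
  · simp

/-- Every energy-conserving unitary is implemented by gates, with the help of the ancilla. -/
theorem exists_mem_gateMonoid {V : SysOp n d} (hV : V ∈ Matrix.unitaryGroup (Config n d) ℂ)
    {ΔE : ℝ} (hΔE : 0 < ΔE) (hcomm : V * intrinsicHam n d ΔE = intrinsicHam n d ΔE * V) :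
    ∃ W ∈ gateMonoid n d, ∀ ψ : Config n d → ℂ,
      W *ᵥ withAncilla ψ = withAncilla (V *ᵥ ψ) := by
  have hb : ∀ w z, levelSum w ≠ levelSum z → V w z = 0 := by
    intro w z hwz
    have := congrFun (congrFun hcomm w) z
    rw [intrinsicHam_eq, Matrix.mul_diagonal, Matrix.diagonal_mul] at this
    have h1 : (ΔE : ℂ) * V w z * ((levelSum w : ℂ) - levelSum z) = 0 := by
      linear_combination -this
    have h2 : (levelSum w : ℂ) - levelSum z ≠ 0 := sub_ne_zero.2 (by exact_mod_cast hwz)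
    have h3 : (ΔE : ℂ) ≠ 0 := by exact_mod_cast hΔE.ne'
    simpa [h2, h3] using h1
  obtain ⟨W, hW, h, -⟩ : V ∈ assisted (gateMonoid n d) :=
    mem_of_block (e := levelSum) (star_mem_assisted star_mem_gateMonoid)
      (fun x y hxy h => good_assisted hasHops_gateMonoid hxy h) (fun x c hc => phase_mem x hc)
      (Matrix.mem_unitaryGroup_iff'.1 hV) hb
  refine ⟨W, hW, fun ψ => ?_⟩
  rw [← emb_mulVec, Matrix.mulVec_mulVec, h, ← Matrix.mulVec_mulVec, emb_mulVec]

end Embedding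

/-! ### Locality and energy conservation of the gates -/

section Locality

variable {n d : ℕ} {S : Finset (Option (Fin n))}

theorem ActsOn.add {A B : TotOp n d} (hA : ActsOn S A) (hB : ActsOn S B) : ActsOn S (A + B) :=
  ⟨fun x y h => by rw [Matrix.add_apply, hA.1 x y h, hB.1 x y h, add_zero],
    fun x y x' y' h1 h2 h3 => by
      rw [Matrix.add_apply, Matrix.add_apply, hA.2 x y x' y' h1 h2 h3, hB.2 x y x' y' h1 h2 h3]⟩

theorem ActsOn.smul {A : TotOp n d} (hA : ActsOn S A) (c : ℂ) : ActsOn S (c • A) :=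
  ⟨fun x y h => by rw [Matrix.smul_apply, hA.1 x y h, smul_zero],
    fun x y x' y' h1 h2 h3 => by
      rw [Matrix.smul_apply, Matrix.smul_apply, hA.2 x y x' y' h1 h2 h3]⟩

theorem eq_iff_siteLevel (x y : ConfigA n d) : x = y ↔ ∀ s, siteLevel x s = siteLevel y s := by
  refine ⟨fun h s => by rw [h], fun h => Prod.ext (funext fun j => Fin.ext (h (some j))) ?_⟩
  exact Fin.ext (h none)

theorem actsOn_one (S : Finset (Option (Fin n))) : ActsOn S (1 : TotOp n d) := by
  refine ⟨fun x y ⟨s, _, hs⟩ => Matrix.one_apply_ne fun h => hs (by rw [h]), ?_⟩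
  intro x y x' y' h1 h2 h3
  rw [Matrix.one_apply, Matrix.one_apply]
  congr 1
  rw [eq_iff_siteLevel, eq_iff_siteLevel, eq_iff_iff]
  refine forall_congr' fun s => ?_
  by_cases hs : s ∈ S
  · rw [(h3 s hs).1, (h3 s hs).2]
  · exact ⟨fun _ => h2 s hs, fun _ => h1 s hs⟩

theorem actsOn_sys_anc (j : Fin n) (M : Matrix (Fin d) (Fin d) ℂ) (B : Matrix (Fin 2) (Fin 2) ℂ) :
    ActsOn {some j, none} (liftSys (onSystem j M) * onAncilla B) := by
  have hmem : ∀ k, k ≠ j → some k ∉ ({some j, none} : Finset (Option (Fin n))) := by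
    intro k hk
    simp [hk]
  rw [liftSys_mul_onAncilla]
  constructor
  · rintro x y ⟨s, hs, hne⟩
    rw [Matrix.kroneckerMap_apply, onSystem, Matrix.of_apply, if_neg, zero_mul]
    intro h
    rcases s with _ | k
    · simp at hs
    · have hk : k ≠ j := by rintro rfl; simp at hs
      exact hne (congrArg Fin.val (h k hk))
  · intro x y x' y' h1 h2 h3
    have e1 : ∀ k, k ≠ j → x.1 k = y.1 k := fun k hk => Fin.ext (h1 _ (hmem k hk))
    have e2 : ∀ k, k ≠ j → x'.1 k = y'.1 k := fun k hk => Fin.ext (h2 _ (hmem k hk))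
    have e3 := h3 (some j) (by simp)
    have e4 := h3 none (by simp)
    rw [Matrix.kroneckerMap_apply, Matrix.kroneckerMap_apply, onSystem, Matrix.of_apply,
      Matrix.of_apply, if_pos e1, if_pos e2, show x.1 j = x'.1 j from Fin.ext e3.1,
      show y.1 j = y'.1 j from Fin.ext e3.2, show x.2 = x'.2 from Fin.ext e4.1,
      show y.2 = y'.2 from Fin.ext e4.2]

theorem actsOn_sys_sys {j k : Fin n} (hjk : j ≠ k) (M M' : Matrix (Fin d) (Fin d) ℂ) :
    ActsOn {some j, some k} (liftSys (onSystem j M * onSystem k M')) := by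
  have hmem : ∀ i, i ≠ j → i ≠ k → some i ∉ ({some j, some k} : Finset (Option (Fin n))) := by
    intro i hi hi'
    simp [hi, hi']
  constructor
  · rintro x y ⟨s, hs, hne⟩
    rw [liftSys, Matrix.kroneckerMap_apply, onSystem_mul_onSystem_apply hjk]
    rcases s with _ | i
    · rw [Matrix.one_apply_ne (fun h => hne (congrArg Fin.val h)), mul_zero]
    · have hi : i ≠ j := by rintro rfl; simp at hs
      have hi' : i ≠ k := by rintro rfl; simp at hs
      rw [if_neg fun h => hne (congrArg Fin.val (h i hi hi')), zero_mul]
  · intro x y x' y' h1 h2 h3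
    have e1 : ∀ i, i ≠ j → i ≠ k → x.1 i = y.1 i := fun i hi hi' => Fin.ext (h1 _ (hmem i hi hi'))
    have e2 : ∀ i, i ≠ j → i ≠ k → x'.1 i = y'.1 i :=
      fun i hi hi' => Fin.ext (h2 _ (hmem i hi hi'))
    have e3 := h3 (some j) (by simp)
    have e4 := h3 (some k) (by simp)
    have e5 : x.2 = y.2 := Fin.ext (h1 none (by simp))
    have e6 : x'.2 = y'.2 := Fin.ext (h2 none (by simp))
    rw [liftSys, Matrix.kroneckerMap_apply, Matrix.kroneckerMap_apply,
      onSystem_mul_onSystem_apply hjk, onSystem_mul_onSystem_apply hjk, if_pos e1, if_pos e2,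
      show x.1 j = x'.1 j from Fin.ext e3.1, show y.1 j = y'.1 j from Fin.ext e3.2,
      show x.1 k = x'.1 k from Fin.ext e4.1, show y.1 k = y'.1 k from Fin.ext e4.2,
      e5, e6, Matrix.one_apply_eq, Matrix.one_apply_eq]

theorem actsOn_anc (B : Matrix (Fin 2) (Fin 2) ℂ) :
    ActsOn {none} (onAncilla B : TotOp n d) := by
  constructor
  · rintro x y ⟨s, hs, hne⟩
    rcases s with _ | i
    · simp at hs
    · rw [onAncilla, Matrix.kroneckerMap_apply,
        Matrix.one_apply_ne (fun h => hne (congrArg Fin.val (congrFun h i))), zero_mul]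
  · intro x y x' y' h1 h2 h3
    have e1 : x.1 = y.1 := funext fun i => Fin.ext (h1 (some i) (by simp))
    have e2 : x'.1 = y'.1 := funext fun i => Fin.ext (h2 (some i) (by simp))
    have e3 := h3 none (by simp)
    rw [onAncilla, Matrix.kroneckerMap_apply, Matrix.kroneckerMap_apply, e1, e2,
      show x.2 = x'.2 from Fin.ext e3.1, show y.2 = y'.2 from Fin.ext e3.2, Matrix.one_apply_eq,
      Matrix.one_apply_eq]

theorem ActsOn.rot {A : TotOp n d} (h : ActsOn S A) (h' : ActsOn S (star A))
    (h1 : ActsOn S (A * star A)) (h2 : ActsOn S (star A * A)) (α β : ℂ) :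
    ActsOn S (rot A α β) := by
  unfold _root_.rot
  rw [sub_eq_add_neg, ← neg_smul]
  exact ((((actsOn_one S).add (h1.smul _)).add (h2.smul _)).add (h.smul _)).add (h'.smul _)

theorem IsInteraction.isKLocal {A : TotOp n d} (hA : IsInteraction n d A) (θ : ℝ) :
    IsKLocal 2 (gate A θ) := by
  rcases hA with _ | ⟨j, l, hl⟩ | ⟨j, k, hjk, l, l', hl, hl'⟩
  · refine ⟨{none}, by simp, ?_⟩
    rw [gate, Za_mul_Za]
    exact ((actsOn_one _).add ((actsOn_anc _).smul _)).add ((actsOn_one _).smul _)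
  · refine ⟨{some j, none}, Finset.card_le_two, ?_⟩
    have hc := starCommute_sysUnit_ancUnit (n := n) (d := d) j
    rw [Finset.mem_Icc] at hl
    rw [Rja_eq, gate_add_star _ (isHop_ancHop (Finset.mem_Icc.2 hl) j)]
    have h1 : star (ancHop n d j l) = sysUnit n d j (l - 1) l * ancUnit n d 1 0 := by
      rw [ancHop, star_mul, star_sysUnit, star_ancUnit, (hc _ _ _ _).comm]
    refine ActsOn.rot ?_ ?_ ?_ ?_ _ _
    · exact actsOn_sys_anc j _ _
    · rw [h1]
      exact actsOn_sys_anc j _ _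
    · rw [h1, ancHop, mul_assoc, (hc (l - 1) l 0 1).rules.2.2.2.2.1, ancUnit_mul _ _ (by norm_num),
        ← mul_assoc, sysUnit_mul _ _ _ (by omega)]
      exact actsOn_sys_anc j _ _
    · rw [h1, ancHop, mul_assoc, (hc l (l - 1) 1 0).rules.2.2.2.2.1, ancUnit_mul _ _ (by norm_num),
        ← mul_assoc, sysUnit_mul _ _ _ (by omega)]
      exact actsOn_sys_anc j _ _
  · refine ⟨{some j, some k}, Finset.card_le_two, ?_⟩
    have hne := ne_of_succ_eq hjk
    have hc := starCommute_sysUnit (d := d) hne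
    have hact : ∀ r s t u, ActsOn {some j, some k} (sysUnit n d j r s * sysUnit n d k t u) := by
      intro r s t u
      rw [sysUnit, sysUnit, liftSys_mul]
      exact actsOn_sys_sys hne _ _
    rw [Rjk_eq hne, gate_add_star _ (isHop_exchange hne hl hl')]
    rw [Finset.mem_Icc] at hl hl'
    have h1 : star (sysUnit n d j l (l - 1) * star (sysUnit n d k l' (l' - 1)))
        = sysUnit n d j (l - 1) l * sysUnit n d k l' (l' - 1) := by
      rw [star_mul, star_star, star_sysUnit, (hc _ _ _ _).comm]
    refine ActsOn.rot ?_ ?_ ?_ ?_ _ _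
    · rw [star_sysUnit]; exact hact _ _ _ _
    · rw [h1]; exact hact _ _ _ _
    · rw [h1, star_sysUnit, mul_assoc, (hc (l - 1) l (l' - 1) l').rules.2.2.2.2.1,
        sysUnit_mul _ _ _ (by omega), ← mul_assoc, sysUnit_mul _ _ _ (by omega)]
      exact hact _ _ _ _
    · rw [h1, star_sysUnit, mul_assoc, (hc l (l - 1) l' (l' - 1)).rules.2.2.2.2.1,
        sysUnit_mul _ _ _ (by omega), ← mul_assoc, sysUnit_mul _ _ _ (by omega)]
      exact hact _ _ _ _

end Locality

section Energy

variable {n d : ℕ}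

/-- The energy of a basis vector of the systems and the ancilla, in units of `ΔE`. -/
def totalLevel (x : ConfigA n d) : ℕ := levelSum x.1 + x.2

theorem totalHam_eq (ΔE : ℝ) : totalHam n d ΔE =
    Matrix.diagonal fun x : ConfigA n d => (ΔE : ℂ) * totalLevel x := by
  ext x y
  obtain ⟨r, b⟩ := x
  obtain ⟨s, c⟩ := y
  rw [totalHam, intrinsicHam_eq, Matrix.add_apply, Matrix.smul_apply, liftSys, onAncilla,
    Matrix.kroneckerMap_apply, Matrix.kroneckerMap_apply, Matrix.diagonal_apply,
    Matrix.diagonal_apply, Matrix.one_apply, Matrix.one_apply]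
  simp only [totalLevel, ketBra, Matrix.of_apply, smul_eq_mul, Prod.mk.injEq]
  by_cases h : r = s
  · subst h
    by_cases hb : b = c
    · subst hb
      fin_cases b <;> simp [mul_add]
    · have : ¬ ((b : ℕ) = 1 ∧ (c : ℕ) = 1) := fun h => hb (Fin.ext (h.1.trans h.2.symm))
      simp [hb, this]
  · simp [h]

theorem commute_totalHam {A : TotOp n d} (h : ∀ x y, A x y ≠ 0 → totalLevel x = totalLevel y)
    (ΔE : ℝ) : A * totalHam n d ΔE = totalHam n d ΔE * A := by
  ext x y
  rw [totalHam_eq, Matrix.mul_diagonal, Matrix.diagonal_mul]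
  by_cases h0 : A x y = 0
  · simp [h0]
  · rw [h x y h0, mul_comm]

theorem star_totalHam (ΔE : ℝ) : star (totalHam n d ΔE) = totalHam n d ΔE := by
  rw [totalHam_eq, Matrix.star_eq_conjTranspose, Matrix.diagonal_conjTranspose]
  congr 1
  funext x
  simp

theorem commute_totalHam_star {A : TotOp n d} {ΔE : ℝ}
    (h : A * totalHam n d ΔE = totalHam n d ΔE * A) :
    star A * totalHam n d ΔE = totalHam n d ΔE * star A := by
  simpa [star_totalHam] using (congrArg star h).symm

theorem IsInteraction.commute {A : TotOp n d} (hA : IsInteraction n d A) (ΔE : ℝ) :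
    A * totalHam n d ΔE = totalHam n d ΔE * A := by
  rcases hA with _ | ⟨j, l, hl⟩ | ⟨j, k, hjk, l, l', hl, hl'⟩
  · refine commute_totalHam (fun x y h => ?_) ΔE
    rw [Za, onAncilla, Matrix.kroneckerMap_apply] at h
    have h1 : x.1 = y.1 := by
      by_contra h1
      rw [Matrix.one_apply_ne h1, zero_mul] at h
      exact h rfl
    have h2 : x.2 = y.2 := by
      by_contra h2
      refine h ?_
      obtain ⟨r, b⟩ := x
      obtain ⟨s, c⟩ := y
      fin_cases b <;> fin_cases c <;> simp_all [pauliZ]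
    rw [totalLevel, totalLevel, h1, h2]
  · rw [Finset.mem_Icc] at hl
    have h : ancHop n d j l * totalHam n d ΔE = totalHam n d ΔE * ancHop n d j l := by
      refine commute_totalHam (fun x y h => ?_) ΔE
      rw [ancHop, sysUnit_mul_ancUnit_apply] at h
      obtain ⟨h1, h2, h3, h4, h5⟩ := of_not_not fun h' => h (if_neg h')
      have e : x.1 = Function.update y.1 j (x.1 j) := by
        funext k
        by_cases hk : k = j
        · subst hk; simp
        · rw [Function.update_of_ne hk, h1 k hk]
      have := levelSum_update y.1 j (x.1 j)
      rw [← e] at this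
      rw [totalLevel, totalLevel, h4, h5]
      simp only [Fin.val_zero, Fin.val_one]
      omega
    rw [Rja_eq, add_mul, mul_add, h, commute_totalHam_star h]
  · have hne := ne_of_succ_eq hjk
    rw [Finset.mem_Icc] at hl hl'
    have h : (sysUnit n d j l (l - 1) * star (sysUnit n d k l' (l' - 1))) * totalHam n d ΔE =
        totalHam n d ΔE * (sysUnit n d j l (l - 1) * star (sysUnit n d k l' (l' - 1))) := by
      refine commute_totalHam (fun x y h => ?_) ΔE
      rw [star_sysUnit, sysUnit, sysUnit, liftSys_mul, liftSys, Matrix.kroneckerMap_apply,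
        onSystem_mul_onSystem_apply hne, ketBra, ketBra, Matrix.of_apply, Matrix.of_apply] at h
      have h1 : x.2 = y.2 := by
        by_contra h1
        rw [Matrix.one_apply_ne h1, mul_zero] at h
        exact h rfl
      have h2 : ∀ i, i ≠ j → i ≠ k → x.1 i = y.1 i := by
        by_contra h2
        rw [if_neg h2, zero_mul] at h
        exact h rfl
      rw [if_pos h2] at h
      have h3 : (x.1 j : ℕ) = l ∧ (y.1 j : ℕ) = l - 1 := by
        by_contra h3
        rw [if_neg h3, zero_mul, zero_mul] at h
        exact h rfl
      have h4 : (x.1 k : ℕ) = l' - 1 ∧ (y.1 k : ℕ) = l' := by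
        by_contra h4
        rw [if_neg h4, mul_zero, zero_mul] at h
        exact h rfl
      have e : x.1 = Function.update (Function.update y.1 j (x.1 j)) k (x.1 k) := by
        funext i
        by_cases hi : i = k
        · subst hi; simp
        · rw [Function.update_of_ne hi]
          by_cases hi' : i = j
          · subst hi'; simp
          · rw [Function.update_of_ne hi', h2 i hi' hi]
      have e1 := levelSum_update y.1 j (x.1 j)
      have e2 := levelSum_update (Function.update y.1 j (x.1 j)) k (x.1 k)
      rw [← e, Function.update_of_ne hne.symm] at e2
      rw [totalLevel, totalLevel, h1]
      omega
    rw [Rjk_eq hne, add_mul, mul_add, h, commute_totalHam_star h]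

theorem gate_commute {𝒜 : Type*} [Ring 𝒜] [Algebra ℂ 𝒜] {A H : 𝒜} (h : A * H = H * A) (θ : ℝ) :
    gate A θ * H = H * gate A θ := by
  unfold gate
  rw [add_mul, add_mul, mul_add, mul_add, smul_mul_assoc, smul_mul_assoc, mul_smul_comm,
    mul_smul_comm, one_mul, mul_one, mul_assoc, h, ← mul_assoc, h, mul_assoc]

theorem IsGate.unitary {G : TotOp n d} (hG : IsGate n d G) :
    G ∈ Matrix.unitaryGroup (ConfigA n d) ℂ := by
  obtain ⟨A, hA, θ, rfl⟩ := isGate_iff.1 hG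
  exact Matrix.mem_unitaryGroup_iff.2 (hA.gate_mul_star θ)

end Energy

/-! ### Implementation by a time-dependent Hamiltonian -/

section Implementation

/-- A smooth pulse between the times `T` and `T + τ` of total area `θ`. -/
theorem exists_pulse (T θ : ℝ) {τ : ℝ} (hτ : 0 < τ) : ∃ φ g : ℝ → ℝ, Continuous g ∧
    (∀ t, HasDerivAt φ (g t) t) ∧ (∀ t ≤ T, φ t = 0) ∧ (∀ t, T + τ ≤ t → φ t = θ) ∧
    ∀ t, t < T ∨ T + τ < t → g t = 0 := by
  have hφ : ContDiff ℝ 1 fun t => θ * Real.smoothTransition ((t - T) / τ) :=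
    contDiff_const.mul (Real.smoothTransition.contDiff.comp
      ((contDiff_id.sub contDiff_const).div_const τ))
  have h0 : ∀ t ≤ T, θ * Real.smoothTransition ((t - T) / τ) = 0 := by
    intro t ht
    rw [Real.smoothTransition.zero_of_nonpos, mul_zero]
    exact div_nonpos_of_nonpos_of_nonneg (by linarith) hτ.le
  have h1 : ∀ t, T + τ ≤ t → θ * Real.smoothTransition ((t - T) / τ) = θ := by
    intro t ht
    rw [Real.smoothTransition.one_of_one_le, mul_one]
    exact (one_le_div hτ).2 (by linarith)
  refine ⟨_, _, hφ.continuous_deriv le_rfl,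
    fun t => (hφ.differentiable one_ne_zero t).hasDerivAt, h0, h1, ?_⟩
  rintro t (ht | ht)
  · rw [Filter.EventuallyEq.deriv_eq (f := fun _ => (0 : ℝ)), deriv_const]
    filter_upwards [Iio_mem_nhds ht] with s hs using h0 s (le_of_lt hs)
  · rw [Filter.EventuallyEq.deriv_eq (f := fun _ => θ), deriv_const]
    filter_upwards [Ioi_mem_nhds ht] with s hs using h1 s (le_of_lt hs)

/-- The product rule for matrix-valued functions of time, in terms of matrix entries. -/
theorem hasDerivWithinAt_mul_apply {m : Type*} [Fintype m] {P U : ℝ → Matrix m m ℂ}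
    {P' U' : Matrix m m ℂ} {s : Set ℝ} {t : ℝ}
    (hP : ∀ x y, HasDerivWithinAt (fun s => P s x y) (P' x y) s t)
    (hU : ∀ x y, HasDerivWithinAt (fun s => U s x y) (U' x y) s t) (x y : m) :
    HasDerivWithinAt (fun s => (P s * U s) x y) ((P' * U t + P t * U') x y) s t := by
  simp only [Matrix.mul_apply, Matrix.add_apply]
  rw [← Finset.sum_add_distrib]
  exact HasDerivWithinAt.fun_sum fun z _ => (hP x z).mul (hU z y)

theorem hasDerivAt_gate_apply {m : Type*} [Fintype m] [DecidableEq m] {A : Matrix m m ℂ}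
    (hA : A * A * A = A) {φ : ℝ → ℝ} {c t : ℝ} (hφ : HasDerivAt φ c t) (x y : m) :
    HasDerivAt (fun s => gate A (φ s) x y) (((Complex.I * c) • (A * gate A (φ t))) x y) t := by
  have e : (Complex.I * c) • (A * gate A (φ t)) =
      (Complex.I * ((Real.cos (φ t) * c : ℝ) : ℂ)) • A
        + ((-Real.sin (φ t) * c : ℝ) : ℂ) • (A * A) := by
    rw [gate, mul_add, mul_add, mul_one, mul_smul_comm, mul_smul_comm, ← mul_assoc, hA]
    push_cast
    match_scalars
    · ring
    · linear_combination (c * Complex.sin (φ t)) * Complex.I_mul_I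
  rw [e]
  simp only [gate, Matrix.add_apply, Matrix.smul_apply, smul_eq_mul]
  have h1 := ((hφ.sin.ofReal_comp.const_mul Complex.I).mul_const (A x y)).const_add
    ((1 : Matrix m m ℂ) x y)
  exact h1.add ((hφ.cos.ofReal_comp.sub_const 1).mul_const ((A * A) x y))

variable {n d : ℕ}

/-- The evolution generated by `totalHam` alone. -/
noncomputable def freeEvolution (n d : ℕ) (ΔE t : ℝ) : TotOp n d :=
  Matrix.diagonal fun x => Complex.exp (-Complex.I * (ΔE * totalLevel x) * t)

/-- All the energies are multiples of `ΔE`, so that the free evolution is periodic. -/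
theorem freeEvolution_period {ΔE : ℝ} (hΔE : 0 < ΔE) (k : ℕ) :
    freeEvolution n d ΔE (k * (2 * Real.pi / ΔE)) = 1 := by
  rw [← Matrix.diagonal_one, freeEvolution]
  congr 1
  funext x
  have h : (ΔE : ℂ) ≠ 0 := by exact_mod_cast hΔE.ne'
  rw [Complex.exp_eq_one_iff]
  refine ⟨-(totalLevel x * k : ℕ), ?_⟩
  push_cast
  field_simp

theorem hasDerivAt_freeEvolution (ΔE t : ℝ) (x y : ConfigA n d) :
    HasDerivAt (fun s => freeEvolution n d ΔE s x y)
      (((-Complex.I) • (totalHam n d ΔE * freeEvolution n d ΔE t)) x y) t := by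
  rw [totalHam_eq, freeEvolution, Matrix.diagonal_mul_diagonal]
  simp only [freeEvolution, Matrix.smul_apply, Matrix.diagonal_apply]
  by_cases h : x = y
  · simp only [if_pos h]
    have h1 : HasDerivAt (fun s : ℝ => -Complex.I * (ΔE * totalLevel x) * (s : ℂ))
        (-Complex.I * (ΔE * totalLevel x)) t := by
      simpa using (Complex.ofRealCLM.hasDerivAt (x := t)).const_mul
        (-Complex.I * (ΔE * totalLevel x : ℂ))
    convert h1.cexp using 1
    rw [smul_eq_mul]
    ring
  · simp only [if_neg h, smul_zero]
    exact hasDerivAt_const t 0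

theorem IsInteraction.commute_freeEvolution {A : TotOp n d} (hA : IsInteraction n d A)
    (ΔE t : ℝ) : A * freeEvolution n d ΔE t = freeEvolution n d ΔE t * A := by
  ext x y
  have h := congrFun (congrFun (hA.commute 1) x) y
  rw [totalHam_eq, Matrix.mul_diagonal, Matrix.diagonal_mul] at h
  rw [freeEvolution, Matrix.mul_diagonal, Matrix.diagonal_mul]
  by_cases h0 : A x y = 0
  · simp [h0]
  · have : (totalLevel x : ℂ) = totalLevel y := by
      simpa [mul_comm (A x y), h0] using h.symm
    rw [this, mul_comm]

/-- Each interaction is switched on by a choice of constant control amplitudes. -/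
theorem IsInteraction.exists_coeff {A : TotOp n d} (hA : IsInteraction n d A) :
    ∃ (cA : ℝ) (cSA : Fin n → ℕ → ℝ) (cSS : Fin n → Fin n → ℕ → ℕ → ℝ),
      (cA : ℂ) • Za n d + ∑ j : Fin n, ∑ l ∈ Finset.Icc 1 (d - 1), (cSA j l : ℂ) • Rja d j l
        + ∑ p ∈ nnPairs n, ∑ l ∈ Finset.Icc 1 (d - 1), ∑ l' ∈ Finset.Icc 1 (d - 1),
          (cSS p.1 p.2 l l' : ℂ) • Rjk d p.1 p.2 l l' = A := by
  rcases hA with _ | ⟨j, l, hl⟩ | ⟨j, k, hjk, l, l', hl, hl'⟩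
  · exact ⟨1, 0, 0, by simp⟩
  · refine ⟨0, fun j' m => if j' = j then if m = l then 1 else 0 else 0, 0, ?_⟩
    rw [Finset.sum_eq_single j, Finset.sum_eq_single l]
    · simp
    · intro m _ hm; simp [hm]
    · exact fun h => absurd hl h
    · intro i _ hi; simp [hi]
    · simp
  · refine ⟨0, 0, fun j' k' m m' =>
      if (j', k') = (j, k) then if m = l then if m' = l' then 1 else 0 else 0 else 0, ?_⟩
    rw [Finset.sum_eq_single (j, k), Finset.sum_eq_single l, Finset.sum_eq_single l']
    · simp
    · intro m _ hm; simp [hm]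
    · exact fun h => absurd hl' h
    · intro m _ hm; simp [hm]
    · exact fun h => absurd hl h
    · intro p _ hp
      simp only [Prod.mk.eta, if_neg hp, Complex.ofReal_zero, zero_smul, Finset.sum_const_zero]
    · intro h
      exact absurd (by simpa [nnPairs] using hjk) h

theorem controlledHam_add (ΔE : ℝ) (gA : ℝ → ℝ) (gSA : Fin n → ℕ → ℝ → ℝ)
    (gSS : Fin n → Fin n → ℕ → ℕ → ℝ → ℝ) (cA : ℝ) (cSA : Fin n → ℕ → ℝ)
    (cSS : Fin n → Fin n → ℕ → ℕ → ℝ) (g : ℝ → ℝ) (t : ℝ) :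
    controlledHam n d ΔE (fun s => gA s + g s * cA) (fun j l s => gSA j l s + g s * cSA j l)
      (fun j k l l' s => gSS j k l l' s + g s * cSS j k l l') t =
    controlledHam n d ΔE gA gSA gSS t + (g t : ℂ) •
      ((cA : ℂ) • Za n d + ∑ j : Fin n, ∑ l ∈ Finset.Icc 1 (d - 1), (cSA j l : ℂ) • Rja d j l
        + ∑ p ∈ nnPairs n, ∑ l ∈ Finset.Icc 1 (d - 1), ∑ l' ∈ Finset.Icc 1 (d - 1),
          (cSS p.1 p.2 l l' : ℂ) • Rjk d p.1 p.2 l l') := by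
  simp only [controlledHam, Complex.ofReal_add, Complex.ofReal_mul, add_smul, mul_smul,
    Finset.sum_add_distrib, smul_add, Finset.smul_sum]
  abel

theorem controlledHam_zero {ΔE : ℝ} {gA : ℝ → ℝ} {gSA : Fin n → ℕ → ℝ → ℝ}
    {gSS : Fin n → Fin n → ℕ → ℕ → ℝ → ℝ} {t : ℝ} (hA : gA t = 0) (hSA : ∀ j l, gSA j l t = 0)
    (hSS : ∀ j k l l', gSS j k l l' t = 0) :
    controlledHam n d ΔE gA gSA gSS t = totalHam n d ΔE := by
  simp [controlledHam, hA, hSA, hSS]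

theorem IsControl.add_pulse {T τ : ℝ} (hT : 0 ≤ T) (hτ : 0 ≤ τ) {f g : ℝ → ℝ}
    (hf : IsControl T f) (hg : Continuous g) (hg0 : ∀ t, t < T ∨ T + τ < t → g t = 0) (c : ℝ) :
    IsControl (T + τ) fun t => f t + -g t * c := by
  refine ⟨hf.1.add (hg.neg.mul_const c), ?_⟩
  rintro t (ht | ht) <;> beta_reduce
  · rw [hf.2 t (.inl ht), hg0 t (.inl (by linarith))]; simp
  · rw [hf.2 t (.inr (by linarith)), hg0 t (.inr ht)]; simp

/-- The operator `W` is implemented in the frame rotating with the free evolution: suitable controls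
that vanish after the time `T` produce, from then on, the free evolution composed with `W`. -/
def Drives (n d : ℕ) (ΔE T : ℝ) (W : TotOp n d) : Prop :=
  ∃ (gA : ℝ → ℝ) (gSA : Fin n → ℕ → ℝ → ℝ) (gSS : Fin n → Fin n → ℕ → ℕ → ℝ → ℝ),
    IsControl T gA ∧ (∀ j l, IsControl T (gSA j l)) ∧ (∀ j k l l', IsControl T (gSS j k l l')) ∧
    ∃ U : ℝ → TotOp n d, U 0 = 1 ∧
      (∀ t, 0 ≤ t → ∀ x y, HasDerivWithinAt (fun s => U s x y)
        (((-Complex.I) • (controlledHam n d ΔE gA gSA gSS t * U t)) x y) (Set.Ici 0) t) ∧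
      ∀ t, T ≤ t → U t = freeEvolution n d ΔE t * W

theorem drives_one (ΔE : ℝ) : Drives n d ΔE 0 1 := by
  have h0 : IsControl 0 fun _ => 0 := ⟨continuous_const, fun _ _ => rfl⟩
  refine ⟨fun _ => 0, fun _ _ _ => 0, fun _ _ _ _ _ => 0, h0, fun _ _ => h0, fun _ _ _ _ => h0,
    freeEvolution n d ΔE, ?_, fun t _ x y => ?_, fun t _ => (mul_one _).symm⟩
  · rw [freeEvolution, ← Matrix.diagonal_one]
    congr 1
    funext x
    simp
  · rw [controlledHam_zero rfl (fun _ _ => rfl) fun _ _ _ _ => rfl]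
    exact (hasDerivAt_freeEvolution ΔE t x y).hasDerivWithinAt

/-- A further gate is applied by a pulse of its interaction: the interaction commutes with the
free evolution, which is all that the earlier controls leave behind. -/
theorem Drives.gate_mul {ΔE T τ : ℝ} (hT : 0 ≤ T) (hτ : 0 < τ) {W A : TotOp n d}
    (hW : Drives n d ΔE T W) (hA : IsInteraction n d A) (θ : ℝ) :
    Drives n d ΔE (T + τ) (gate A θ * W) := by
  obtain ⟨gA, gSA, gSS, h1, h2, h3, U, hU0, hU, hUT⟩ := hW
  obtain ⟨φ, g, hg, hφ, hφ0, hφ1, hg0⟩ := exists_pulse T θ hτ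
  obtain ⟨cA, cSA, cSS, hc⟩ := hA.exists_coeff
  refine ⟨_, _, _, h1.add_pulse hT hτ.le hg hg0 cA,
    fun j l => (h2 j l).add_pulse hT hτ.le hg hg0 (cSA j l),
    fun j k l l' => (h3 j k l l').add_pulse hT hτ.le hg hg0 (cSS j k l l'),
    fun t => gate A (φ t) * U t, ?_, fun t ht x y => ?_, fun t ht => ?_⟩
  · beta_reduce
    rw [hφ0 0 hT, gate_zero, one_mul, hU0]
  · have hcomm : gate A (φ t) * controlledHam n d ΔE gA gSA gSS t =
        controlledHam n d ΔE gA gSA gSS t * gate A (φ t) := by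
      rcases le_or_gt t T with h | h
      · rw [hφ0 t h, gate_zero, one_mul, mul_one]
      · rw [controlledHam_zero (h1.2 t (.inr h)) (fun j l => (h2 j l).2 t (.inr h))
          fun j k l l' => (h3 j k l l').2 t (.inr h)]
        exact gate_commute (hA.commute ΔE) _
    convert hasDerivWithinAt_mul_apply
      (fun x y => (hasDerivAt_gate_apply hA.cube (hφ t) x y).hasDerivWithinAt) (hU t ht) x y
      using 1
    have hH := controlledHam_add (d := d) ΔE gA gSA gSS cA cSA cSS (fun s => -g s) t
    rw [hc] at hH
    rw [hH, add_mul, mul_smul_comm, ← mul_assoc (gate A (φ t)), hcomm, smul_add, smul_mul_assoc,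
      smul_smul, smul_mul_assoc, mul_assoc, mul_assoc, add_comm]
    push_cast
    rw [neg_mul_neg]
  · beta_reduce
    rw [hφ1 t ht, hUT t (by linarith), ← mul_assoc, ← mul_assoc,
      gate_commute (hA.commute_freeEvolution ΔE t)]

theorem isImplementable_of_mem {ΔE : ℝ} (hΔE : 0 < ΔE) {W : TotOp n d}
    (hW : W ∈ gateMonoid n d) : IsImplementable n d ΔE W := by
  -- every gate takes one period of the free evolution
  have hτ : 0 < 2 * Real.pi / ΔE := div_pos Real.two_pi_pos hΔE
  have h : ∃ k : ℕ, Drives n d ΔE (k * (2 * Real.pi / ΔE)) W := by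
    induction hW using Submonoid.closure_induction_left with
    | one => exact ⟨0, by simpa using drives_one ΔE⟩
    | mul_left G hG W _ ih =>
      obtain ⟨A, hA, θ, rfl⟩ := isGate_iff.1 hG
      obtain ⟨k, hk⟩ := ih
      refine ⟨k + 1, ?_⟩
      have := hk.gate_mul (by positivity) hτ hA θ
      rwa [← add_one_mul, ← Nat.cast_add_one] at this
  obtain ⟨k, gA, gSA, gSS, h1, h2, h3, U, hU0, hU, hUT⟩ := h
  refine ⟨_, by positivity, gA, gSA, gSS, h1, h2, h3, U, hU0, hU, ?_⟩
  rw [hUT _ le_rfl, freeEvolution_period hΔE, one_mul]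

end Implementation

/-! ### Qubits -/

section Qubits

variable {n : ℕ}

theorem sum_pauliZ_eq :
    ∑ j : Fin n, (onSystem j pauliZ : SysOp n 2) = (n : ℂ) • 1 - (2 : ℂ) • intrinsicHam n 2 1 := by
  have h : ∀ j : Fin n, (onSystem j pauliZ : SysOp n 2) =
      1 - (2 : ℂ) • onSystem j (singleHam 2 1) := by
    intro j
    have hZ : pauliZ = 1 - (2 : ℂ) • singleHam 2 1 := by
      ext i k
      fin_cases i <;> fin_cases k <;>
        (simp [pauliZ, singleHam, ketBra, Finset.sum_range_succ]; try norm_num)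
    ext r s
    rw [hZ, Matrix.sub_apply, Matrix.smul_apply, onSystem, onSystem, Matrix.of_apply,
      Matrix.of_apply, Matrix.sub_apply, Matrix.smul_apply, Matrix.one_apply, Matrix.one_apply]
    by_cases hrs : ∀ k, k ≠ j → r k = s k
    · rw [if_pos hrs, if_pos hrs]
      congr 2
      refine propext ⟨fun hj => funext fun k => ?_, fun hj => by rw [hj]⟩
      by_cases hk : k = j
      · rw [hk, hj]
      · exact hrs k hk
    · rw [if_neg hrs, if_neg hrs, if_neg fun hr => hrs fun k _ => by rw [hr]]
      simp
  rw [Finset.sum_congr rfl fun j _ => h j, Finset.sum_sub_distrib, ← Finset.smul_sum, intrinsicHam,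
    Finset.sum_const, Finset.card_univ, Fintype.card_fin, ← Nat.cast_smul_eq_nsmul ℂ]

/-- On two qubits, `XX + YY` is twice the exchange of an excitation. The differences `1 - 1` match
`Rja` and `Rjk` at `l = l' = 1`. -/
theorem pauli_exchange (a b a' b' : Fin 2) :
    pauliX a b * pauliX a' b' + pauliY a b * pauliY a' b' =
      2 * (ketBra 2 (1 - 1) 1 a b * ketBra 2 1 (1 - 1) a' b' +
        ketBra 2 1 (1 - 1) a b * ketBra 2 (1 - 1) 1 a' b') := by
  fin_cases a <;> fin_cases b <;> fin_cases a' <;> fin_cases b' <;>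
    simp [pauliX, pauliY, ketBra] <;> norm_num

theorem pauli_sysAnc (j : Fin n) :
    (liftSys (onSystem j pauliX) * onAncilla pauliX
      + liftSys (onSystem j pauliY) * onAncilla pauliY : TotOp n 2) = (2 : ℂ) • Rja 2 j 1 := by
  ext x y
  simp only [Rja, liftSys_mul_onAncilla, Matrix.add_apply, Matrix.smul_apply,
    Matrix.kroneckerMap_apply, onSystem, Matrix.of_apply, smul_eq_mul]
  by_cases h : ∀ k, k ≠ j → x.1 k = y.1 k
  · simp only [if_pos h]
    exact pauli_exchange _ _ _ _
  · simp only [if_neg h]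
    ring

theorem pauli_sysSys {j k : Fin n} (hjk : j ≠ k) :
    (liftSys (onSystem j pauliX * onSystem k pauliX)
      + liftSys (onSystem j pauliY * onSystem k pauliY) : TotOp n 2) =
      (2 : ℂ) • Rjk 2 j k 1 1 := by
  ext x y
  simp only [Rjk, liftSys, Matrix.add_apply, Matrix.smul_apply,
    Matrix.kroneckerMap_apply, onSystem_mul_onSystem_apply hjk, smul_eq_mul]
  rw [← add_mul, ← add_mul, ← mul_assoc]
  congr 1
  by_cases h : ∀ i, i ≠ j → i ≠ k → x.1 i = y.1 i
  · simp only [if_pos h]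
    exact pauli_exchange _ _ _ _
  · simp only [if_neg h]
    ring

theorem IsGate.isXYGate {G : TotOp n 2} (hG : IsGate n 2 G) : IsXYGate n G := by
  have half : ∀ (θ : ℝ) (R : TotOp n 2),
      (Complex.I * (θ : ℂ)) • R = (Complex.I * ((θ / 2 : ℝ) : ℂ)) • (2 : ℂ) • R := by
    intro θ R
    rw [smul_smul]
    congr 1
    push_cast
    ring
  obtain ⟨A, hA, θ, -, rfl⟩ := hG
  rcases hA with _ | ⟨j, l, hl⟩ | ⟨j, k, hjk, l, l', hl, hl'⟩
  · exact ⟨_, .anc, θ, rfl⟩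
  · obtain rfl : l = 1 := by simpa using hl
    exact ⟨_, .sysAnc j, θ / 2, by rw [pauli_sysAnc, half]⟩
  · obtain rfl : l = 1 := by simpa using hl
    obtain rfl : l' = 1 := by simpa using hl'
    exact ⟨_, .sysSys j k hjk, θ / 2, by rw [pauli_sysSys (ne_of_succ_eq hjk), half]⟩

end Qubits

theorem gateMonoid_le_unitaryGroup (n d : ℕ) :
    gateMonoid n d ≤ Matrix.unitaryGroup (ConfigA n d) ℂ :=
  Submonoid.closure_le.2 fun _ hG => IsGate.unitary hG

theorem theorem1 (n d : ℕ) (ΔE : ℝ) (hΔE : 0 < ΔE) :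
    -- the general claim, for `n` systems with `d` equally spaced levels
    (∀ V ∈ Matrix.unitaryGroup (Config n d) ℂ,
      V * intrinsicHam n d ΔE = intrinsicHam n d ΔE * V →
      ∃ W ∈ Matrix.unitaryGroup (ConfigA n d) ℂ,
        (∀ ψ : Config n d → ℂ, W *ᵥ withAncilla ψ = withAncilla (V *ᵥ ψ)) ∧
        (∃ L : List (TotOp n d),
          (∀ G ∈ L, IsGate n d G ∧ G ∈ Matrix.unitaryGroup (ConfigA n d) ℂ ∧ IsKLocal 2 G ∧
            G * totalHam n d ΔE = totalHam n d ΔE * G) ∧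
          L.prod = W) ∧
        IsImplementable n d ΔE W) ∧
    -- qubits: `XX + YY` and a local `Z` on the ancilla give all U(1)-invariant unitaries
    (∀ V ∈ Matrix.unitaryGroup (Config n 2) ℂ,
      V * (∑ j : Fin n, onSystem j pauliZ) = (∑ j : Fin n, onSystem j pauliZ) * V →
      ∃ W ∈ Matrix.unitaryGroup (ConfigA n 2) ℂ,
        (∀ ψ : Config n 2 → ℂ, W *ᵥ withAncilla ψ = withAncilla (V *ᵥ ψ)) ∧
        ∃ L : List (TotOp n 2), (∀ G ∈ L, IsXYGate n G) ∧ L.prod = W) := by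
  constructor
  · intro V hV hcomm
    obtain ⟨W, hW, hψ⟩ := exists_mem_gateMonoid hV hΔE hcomm
    obtain ⟨L, hL, rfl⟩ := Submonoid.exists_list_of_mem_closure hW
    refine ⟨_, gateMonoid_le_unitaryGroup n d hW, hψ, ⟨L, fun G hG => ?_, rfl⟩,
      isImplementable_of_mem hΔE hW⟩
    have hG' : IsGate n d G := hL G hG
    obtain ⟨A, hA, θ, rfl⟩ := isGate_iff.1 hG'
    exact ⟨hG', hG'.unitary, hA.isKLocal θ, gate_commute (hA.commute ΔE) θ⟩
  · intro V hV hcomm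
    rw [sum_pauliZ_eq, mul_sub, sub_mul, mul_smul_comm, smul_mul_assoc, mul_one, one_mul,
      sub_right_inj, mul_smul_comm, smul_mul_assoc] at hcomm
    obtain ⟨W, hW, hψ⟩ := exists_mem_gateMonoid hV one_pos
      (smul_right_injective _ (two_ne_zero (α := ℂ)) hcomm)
    obtain ⟨L, hL, rfl⟩ := Submonoid.exists_list_of_mem_closure hW
    exact ⟨_, gateMonoid_le_unitaryGroup n 2 hW, hψ, L, fun G hG => (hL G hG).isXYGate, rfl⟩
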